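/- A conic in $\mathbb{CP}^2$ is a point of $\mathbb{CP}^5$: a non-zero symmetric $3\times 3$ complex matrix up to scaling. Let $\mathfrak{O}\subset\mathbb{CP}^5\times\mathbb{CP}^5$ be the open set of pairs $(C,D)$ of non-degenerate conics that intersect transversely (equivalently, in four distinct points). Two pairs $(C,D)$, $(C',D')$ are equivalent if, for some $A\in GL_3(\mathbb{C})$, $C'\sim A^TCA$ and $D'\sim A^TDA$, where $\sim$ is equality up to a non-zero scalar; let $\mathcal{M}$ be the space of equivalence classes and $\pi:\mathfrak{O}\to\mathcal{M}$ the projection. Sending the class of $(C,D)$ to the three (distinct, non-zero) roots $\lambda_1,\lambda_2,\lambda_3$ of $\det(xC+D)$ embeds $\mathcal{M}$ in $\mathbb{CP}^2/S_3\cong\mathbb{P}(1,2,3)$. With the induced complex structure $\mathcal{M}$ is a two-dimensional complex manifold away from the single point $m_0=[1:\omega:\omega^2]$, $\omega=e^{2\pi i/3}$, where it has a quotient singularity; put $\mathcal{M}^\circ=\mathcal{M}\setminus\{m_0\}$. Let $j:\mathfrak{O}\to\mathbb{C}$ assign to $(C,D)$ the $j$-invariant of the elliptic curve $y^2=\det(xC+D)$.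 **Theorem.** There is a unique map $\overline{j}:\mathcal{M}\to\mathbb{C}$ with $j=\overline{j}\circ\pi$, and $\overline{j}$ is holomorphic on $\mathcal{M}^\circ$. Let $X\subset\mathcal{M}$ be the curve defined by $$(\lambda_1-2\lambda_2+\lambda_3)(\lambda_1+\lambda_2-2\lambda_3)(2\lambda_1-\lambda_2-\lambda_3)\,(\lambda_1^2-\lambda_1\lambda_2-\lambda_1\lambda_3+\lambda_2^2-\lambda_2\lambda_3+\lambda_3^2)^2=0 .$$ Then $m_0\in X$, and $\overline{j}$ is a submersion at every point of $\mathcal{M}\setminus X$. The set of critical values of $\overline{j}|_{\mathcal{M}^\circ}$ is $\{0,1728\}$. The function $j$ is holomorphic on $\mathfrak{O}$, it is a submersion at every point outside $\pi^{-1}(X)$, and its set of critical values is also $\{0,1728\}$. These values correspond to the elliptic curves with a special automorphism group: the automorphism group of $y^2=\det(xC+D)$ has order $6$ if $j(C,D)=0$, order $4$ if $j(C,D)=1728$, and order $2$ otherwise. -/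

import Mathlib

open scoped LinearAlgebra.Projectivization Manifold ContDiff Matrix Topology
open Polynomial Topology

noncomputable section

namespace ConicPairs

/-! ## Complex projective space as a complex manifold -/

section ProjectiveSpace

variable {n : ℕ}

/-- `ℂℙⁿ`, carrying the quotient topology of `ℂⁿ⁺¹ ∖ {0}`. -/
instance projTopology : TopologicalSpace (ℙ ℂ (Fin (n + 1) → ℂ)) :=
  inferInstanceAs (TopologicalSpace
    (Quotient (projectivizationSetoid ℂ (Fin (n + 1) → ℂ))))

theorem isQuotientMap_mk' :
    IsQuotientMap (Projectivization.mk' ℂ : {v : Fin (n + 1) → ℂ // v ≠ 0} → _) :=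
  isQuotientMap_quotient_mk'

theorem isOpenQuotientMap_mk' :
    IsOpenQuotientMap (Projectivization.mk' ℂ : {v : Fin (n + 1) → ℂ // v ≠ 0} → _) := by
  refine ⟨isQuotientMap_mk'.surjective, isQuotientMap_mk'.continuous, fun s hs => ?_⟩
  rw [← isQuotientMap_mk'.isOpen_preimage]
  have key : (Projectivization.mk' ℂ) ⁻¹' ((Projectivization.mk' ℂ) '' s) =
      ⋃ a : ℂˣ, {v : {v : Fin (n + 1) → ℂ // v ≠ 0} |
        (⟨a • v.1, fun h => v.2 ((smul_eq_zero_iff_eq a).1 h)⟩ :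
          {v : Fin (n + 1) → ℂ // v ≠ 0}) ∈ s} := by
    ext v
    simp only [Set.mem_preimage, Set.mem_image, Set.mem_iUnion, Set.mem_ofPred_eq]
    constructor
    · rintro ⟨w, hw, h⟩
      obtain ⟨a, ha⟩ := (Projectivization.mk_eq_mk_iff ℂ _ _ w.2 v.2).1 h
      exact ⟨a, by convert hw⟩
    · rintro ⟨a, ha⟩
      exact ⟨_, ha, (Projectivization.mk_eq_mk_iff ℂ _ _ _ v.2).2 ⟨a, rfl⟩⟩
  rw [key]
  refine isOpen_iUnion fun a => hs.preimage ?_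
  exact Continuous.subtype_mk (continuous_subtype_val.const_smul a) _

theorem rep_mk_div (v : Fin (n + 1) → ℂ) (hv : v ≠ 0) (i j : Fin (n + 1)) :
    (Projectivization.mk ℂ v hv).rep i / (Projectivization.mk ℂ v hv).rep j = v i / v j := by
  obtain ⟨a, ha⟩ := Projectivization.exists_smul_eq_mk_rep ℂ v hv
  rw [← ha]
  simp only [Pi.smul_apply, Units.smul_def, smul_eq_mul]
  exact mul_div_mul_left _ _ a.ne_zero

theorem rep_mk_ne_zero_iff (v : Fin (n + 1) → ℂ) (hv : v ≠ 0) (i : Fin (n + 1)) :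
    (Projectivization.mk ℂ v hv).rep i ≠ 0 ↔ v i ≠ 0 := by
  obtain ⟨a, ha⟩ := Projectivization.exists_smul_eq_mk_rep ℂ v hv
  rw [← ha]
  simp [Units.smul_def]

/-- The vector with `i`-th coordinate `1` and remaining coordinates `y`. -/
def homog (i : Fin (n + 1)) (y : Fin n → ℂ) : Fin (n + 1) → ℂ :=
  i.insertNth (α := fun _ => ℂ) 1 y

@[simp] theorem homog_self (i : Fin (n + 1)) (y : Fin n → ℂ) : homog i y i = 1 := by
  simp [homog]

@[simp] theorem homog_succAbove (i : Fin (n + 1)) (y : Fin n → ℂ) (k : Fin n) :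
    homog i y (i.succAbove k) = y k := by
  simp [homog]

theorem homog_ne_zero (i : Fin (n + 1)) (y : Fin n → ℂ) :
    homog i y ≠ 0 := fun h => by
  have := congrFun h i
  simp at this

theorem continuous_homog (i : Fin (n + 1)) :
    Continuous fun y : Fin n → ℂ => homog i y := by
  refine continuous_pi fun j => ?_
  rcases Fin.eq_self_or_eq_succAbove i j with rfl | ⟨k, rfl⟩
  · simpa using continuous_const
  · simpa using continuous_apply k

/-- The standard affine chart `[x] ↦ (x_k / x_i)_{k ≠ i}` on `{x_i ≠ 0} ⊆ ℂℙⁿ`. -/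
def affineChart (i : Fin (n + 1)) :
    OpenPartialHomeomorph (ℙ ℂ (Fin (n + 1) → ℂ)) (Fin n → ℂ) where
  toFun x := fun k => x.rep (i.succAbove k) / x.rep i
  invFun y := Projectivization.mk ℂ (homog i y) (homog_ne_zero i y)
  source := {x | x.rep i ≠ 0}
  target := Set.univ
  map_source' _ _ := Set.mem_univ _
  map_target' y _ := by
    rw [Set.mem_ofPred_eq, rep_mk_ne_zero_iff]
    simp
  left_inv' x hx := by
    have hx' : x.rep i ≠ 0 := hx
    conv_rhs => rw [← Projectivization.mk_rep x]
    rw [Projectivization.mk_eq_mk_iff']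
    refine ⟨(x.rep i)⁻¹, ?_⟩
    funext j
    rcases Fin.eq_self_or_eq_succAbove i j with rfl | ⟨k, rfl⟩
    · simp [hx']
    · simp [div_eq_inv_mul]
  right_inv' y _ := by
    funext k
    rw [rep_mk_div]
    simp
  open_source := by
    rw [← isQuotientMap_mk'.isOpen_preimage]
    have : (Projectivization.mk' ℂ) ⁻¹' {x : ℙ ℂ (Fin (n + 1) → ℂ) | x.rep i ≠ 0} =
        {v : {v : Fin (n + 1) → ℂ // v ≠ 0} | v.1 i ≠ 0} := by
      ext v
      exact rep_mk_ne_zero_iff v.1 v.2 i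
    rw [this]
    exact isOpen_ne_fun ((continuous_apply i).comp continuous_subtype_val) continuous_const
  open_target := isOpen_univ
  continuousOn_toFun := by
    have hopen : IsOpen {x : ℙ ℂ (Fin (n + 1) → ℂ) | x.rep i ≠ 0} := by
      rw [← isQuotientMap_mk'.isOpen_preimage]
      have : (Projectivization.mk' ℂ) ⁻¹' {x : ℙ ℂ (Fin (n + 1) → ℂ) | x.rep i ≠ 0} =
          {v : {v : Fin (n + 1) → ℂ // v ≠ 0} | v.1 i ≠ 0} := by
        ext v
        exact rep_mk_ne_zero_iff v.1 v.2 i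
      rw [this]
      exact isOpen_ne_fun ((continuous_apply i).comp continuous_subtype_val) continuous_const
    rw [isQuotientMap_mk'.continuousOn_isOpen_iff hopen]
    have : (fun x : ℙ ℂ (Fin (n + 1) → ℂ) => fun k => x.rep (i.succAbove k) / x.rep i) ∘
        (Projectivization.mk' ℂ) = fun v : {v : Fin (n + 1) → ℂ // v ≠ 0} =>
          fun k => v.1 (i.succAbove k) / v.1 i := by
      funext v k
      exact rep_mk_div v.1 v.2 _ _
    rw [this]
    refine continuousOn_pi.2 fun k => ContinuousOn.div
      ((continuous_apply _).comp continuous_subtype_val).continuousOn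
      ((continuous_apply _).comp continuous_subtype_val).continuousOn fun v hv => ?_
    exact (rep_mk_ne_zero_iff v.1 v.2 i).1 hv
  continuousOn_invFun := by
    refine Continuous.continuousOn ?_
    exact isQuotientMap_mk'.continuous.comp
      ((continuous_homog i).subtype_mk (homog_ne_zero i))

theorem exists_rep_ne_zero (x : ℙ ℂ (Fin (n + 1) → ℂ)) : ∃ i, x.rep i ≠ 0 := by
  by_contra! h
  exact x.rep_nonzero (funext h)

/-- The standard atlas of `ℂℙⁿ`. -/
instance projChartedSpace : ChartedSpace (Fin n → ℂ) (ℙ ℂ (Fin (n + 1) → ℂ)) where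
  atlas := Set.range affineChart
  chartAt x := affineChart (exists_rep_ne_zero x).choose
  mem_chart_source x := (exists_rep_ne_zero x).choose_spec
  chart_mem_atlas _ := ⟨_, rfl⟩

instance projIsManifold : IsManifold 𝓘(ℂ, Fin n → ℂ) ω (ℙ ℂ (Fin (n + 1) → ℂ)) := by
  refine isManifold_of_contDiffOn _ _ _ ?_
  rintro _ _ ⟨i, rfl⟩ ⟨j, rfl⟩
  have hcoord : ∀ l : Fin (n + 1), ContDiff ℂ ω fun y : Fin n → ℂ =>
      homog i y l := by
    intro l
    rcases Fin.eq_self_or_eq_succAbove i l with rfl | ⟨k, rfl⟩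
    · simpa using contDiff_const
    · simpa using contDiff_apply ℂ ℂ k
  have hD : ContDiffOn ℂ ω (fun y : Fin n → ℂ => fun k =>
      homog i y (j.succAbove k) /
        homog i y j)
      {y | homog i y j ≠ 0} :=
    contDiffOn_pi.2 fun k => (hcoord _).contDiffOn.div (hcoord _).contDiffOn fun y hy => hy
  refine (hD.congr fun y _ => ?_).mono ?_
  · funext k
    exact rep_mk_div _ _ _ _
  · intro y hy
    have h2 : (Projectivization.mk ℂ (homog i y)
        (homog_ne_zero i y)).rep j ≠ 0 := by
      simpa [affineChart] using hy
    exact (rep_mk_ne_zero_iff _ _ _).1 h2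

end ProjectiveSpace

/-! ## Conics and transverse pairs -/

/-- Plane conics, as points of `ℂℙ⁵`. -/
abbrev Conic := ℙ ℂ (Fin (5 + 1) → ℂ)

/-- The symmetric matrix with upper triangular entries `x₀, …, x₅`. -/
def conicMatrix (x : Fin (5 + 1) → ℂ) : Matrix (Fin 3) (Fin 3) ℂ :=
  !![x 0, x 1, x 2; x 1, x 3, x 4; x 2, x 4, x 5]

/-- The conics `vᵀCv = 0` and `vᵀDv = 0` intersect transversely: at each common point `[v]` the
tangent lines, with coefficient vectors `Cv` and `Dv`, are well defined and distinct. -/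
def Transverse (C D : Matrix (Fin 3) (Fin 3) ℂ) : Prop :=
  ∀ v : Fin 3 → ℂ, v ≠ 0 → v ⬝ᵥ C *ᵥ v = 0 → v ⬝ᵥ D *ᵥ v = 0 →
    LinearIndependent ℂ ![C *ᵥ v, D *ᵥ v]

/-- `x` and `y` are coordinates of two non-degenerate conics intersecting transversely. -/
def Admissible (x y : Fin (5 + 1) → ℂ) : Prop :=
  (conicMatrix x).det ≠ 0 ∧ (conicMatrix y).det ≠ 0 ∧
    Transverse (conicMatrix x) (conicMatrix y)

theorem conicMatrix_smul (a : ℂ) (x : Fin (5 + 1) → ℂ) :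
    conicMatrix (a • x) = a • conicMatrix x := by
  ext i j
  fin_cases i <;> fin_cases j <;> simp [conicMatrix]

theorem conicMatrix_transpose (x : Fin (5 + 1) → ℂ) : (conicMatrix x)ᵀ = conicMatrix x := by
  ext i j
  fin_cases i <;> fin_cases j <;> simp [conicMatrix]

theorem continuous_conicMatrix : Continuous conicMatrix := by
  refine continuous_matrix fun i j => ?_
  fin_cases i <;> fin_cases j <;> simp [conicMatrix] <;> fun_prop

theorem transverse_iff_cross (C D : Matrix (Fin 3) (Fin 3) ℂ) :
    Transverse C D ↔ ∀ v ∈ Metric.sphere (0 : Fin 3 → ℂ) 1,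
      ¬ (v ⬝ᵥ C *ᵥ v = 0 ∧ v ⬝ᵥ D *ᵥ v = 0 ∧ (C *ᵥ v) ⨯₃ (D *ᵥ v) = 0) := by
  constructor
  · rintro h v hv ⟨h1, h2, h3⟩
    have hv0 : v ≠ 0 := by
      rintro rfl
      simp at hv
    exact crossProduct_ne_zero_iff_linearIndependent.2 (h v hv0 h1 h2) h3
  · intro h v hv h1 h2
    rw [← crossProduct_ne_zero_iff_linearIndependent]
    intro h3
    have hn : ‖v‖ ≠ 0 := norm_ne_zero_iff.2 hv
    refine h (((‖v‖⁻¹ : ℝ) : ℂ) • v) ?_ ⟨?_, ?_, ?_⟩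
    · simp [norm_smul, hn]
    · simp [Matrix.mulVec_smul, h1]
    · simp [Matrix.mulVec_smul, h2]
    · simp [Matrix.mulVec_smul, h3]

theorem isOpen_admissible :
    IsOpen {p : (Fin (5 + 1) → ℂ) × (Fin (5 + 1) → ℂ) | Admissible p.1 p.2} := by
  have c1 : Continuous fun p : (Fin (5 + 1) → ℂ) × (Fin (5 + 1) → ℂ) => conicMatrix p.1 :=
    continuous_conicMatrix.comp continuous_fst
  have c2 : Continuous fun p : (Fin (5 + 1) → ℂ) × (Fin (5 + 1) → ℂ) => conicMatrix p.2 :=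
    continuous_conicMatrix.comp continuous_snd
  refine (isOpen_ne_fun c1.matrix_det continuous_const).inter
    ((isOpen_ne_fun c2.matrix_det continuous_const).inter ?_)
  let N : Set (((Fin (5 + 1) → ℂ) × (Fin (5 + 1) → ℂ)) × Metric.sphere (0 : Fin 3 → ℂ) 1) :=
    {q | (q.2 : Fin 3 → ℂ) ⬝ᵥ conicMatrix q.1.1 *ᵥ q.2 = 0 ∧
      (q.2 : Fin 3 → ℂ) ⬝ᵥ conicMatrix q.1.2 *ᵥ q.2 = 0 ∧
      (conicMatrix q.1.1 *ᵥ q.2) ⨯₃ (conicMatrix q.1.2 *ᵥ q.2) = 0}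
  have hv : Continuous fun q : ((Fin (5 + 1) → ℂ) × (Fin (5 + 1) → ℂ)) ×
      Metric.sphere (0 : Fin 3 → ℂ) 1 => (q.2 : Fin 3 → ℂ) :=
    continuous_subtype_val.comp continuous_snd
  have hC := (c1.comp (continuous_fst (Y := Metric.sphere (0 : Fin 3 → ℂ) 1))).matrix_mulVec hv
  have hD := (c2.comp (continuous_fst (Y := Metric.sphere (0 : Fin 3 → ℂ) 1))).matrix_mulVec hv
  have hN : IsClosed N := by
    refine (isClosed_eq (hv.dotProduct hC) continuous_const).inter
      ((isClosed_eq (hv.dotProduct hD) continuous_const).inter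
        (isClosed_eq ?_ continuous_const))
    refine continuous_pi fun i => ?_
    have hCi := fun i => (continuous_apply i).comp hC
    have hDi := fun i => (continuous_apply i).comp hD
    simp only [Function.comp_def] at hCi hDi
    fin_cases i <;> simp [cross_apply] <;>
      exact ((hCi _).mul (hDi _)).sub ((hCi _).mul (hDi _))
  have := isClosedMap_fst_of_compactSpace N hN
  suffices e : {p : (Fin (5 + 1) → ℂ) × (Fin (5 + 1) → ℂ) |
      Transverse (conicMatrix p.1) (conicMatrix p.2)} = (Prod.fst '' N)ᶜ by
    change IsOpen {p : (Fin (5 + 1) → ℂ) × (Fin (5 + 1) → ℂ) |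
      Transverse (conicMatrix p.1) (conicMatrix p.2)}
    rw [e]
    exact this.isOpen_compl
  ext p
  simp only [Set.mem_ofPred_eq, Set.mem_compl_iff, Set.mem_image, not_exists, not_and]
  constructor
  · rintro h ⟨p', v⟩ hq rfl
    exact (transverse_iff_cross _ _).1 h v.1 v.2 hq
  · intro h
    exact (transverse_iff_cross _ _).2 fun v hv hq => h (p, ⟨v, hv⟩) hq rfl

theorem Transverse.smul {C D : Matrix (Fin 3) (Fin 3) ℂ} (h : Transverse C D) {a b : ℂ}
    (ha : a ≠ 0) (hb : b ≠ 0) : Transverse (a • C) (b • D) := by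
  intro v hv h1 h2
  have h1' : v ⬝ᵥ C *ᵥ v = 0 := by simpa [Matrix.smul_mulVec, ha] using h1
  have h2' : v ⬝ᵥ D *ᵥ v = 0 := by simpa [Matrix.smul_mulVec, hb] using h2
  have := h v hv h1' h2'
  rw [← crossProduct_ne_zero_iff_linearIndependent] at this ⊢
  simpa [Matrix.smul_mulVec, ha, hb] using this

theorem Admissible.smul {x y : Fin (5 + 1) → ℂ} (h : Admissible x y) {a b : ℂ}
    (ha : a ≠ 0) (hb : b ≠ 0) : Admissible (a • x) (b • y) := by
  simp only [Admissible, conicMatrix_smul, Matrix.det_smul]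
  exact ⟨mul_ne_zero (pow_ne_zero _ ha) h.1, mul_ne_zero (pow_ne_zero _ hb) h.2.1,
    h.2.2.smul ha hb⟩

theorem exists_rep_smul (x : Fin (5 + 1) → ℂ) (hx : x ≠ 0) :
    ∃ a : ℂ, a ≠ 0 ∧ (Projectivization.mk ℂ x hx).rep = a • x := by
  obtain ⟨a, ha⟩ := Projectivization.exists_smul_eq_mk_rep ℂ x hx
  exact ⟨a, a.ne_zero, ha.symm⟩

theorem admissible_rep_iff (x y : Fin (5 + 1) → ℂ) (hx : x ≠ 0) (hy : y ≠ 0) :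
    Admissible (Projectivization.mk ℂ x hx).rep (Projectivization.mk ℂ y hy).rep ↔
      Admissible x y := by
  obtain ⟨a, ha, e1⟩ := exists_rep_smul x hx
  obtain ⟨b, hb, e2⟩ := exists_rep_smul y hy
  rw [e1, e2]
  refine ⟨fun h => ?_, fun h => h.smul ha hb⟩
  simpa [smul_smul, ha, hb] using h.smul (inv_ne_zero ha) (inv_ne_zero hb)

/-- The space `𝔒 ⊆ ℂℙ⁵ × ℂℙ⁵` of pairs of non-degenerate conics that intersect transversely, an
open complex submanifold of dimension 10. -/
def conicPairs : TopologicalSpace.Opens (Conic × Conic) where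
  carrier := {p | Admissible p.1.rep p.2.rep}
  is_open' := by
    rw [← ((isOpenQuotientMap_mk' (n := 5)).prodMap
      (isOpenQuotientMap_mk' (n := 5))).isQuotientMap.isOpen_preimage]
    have : (Prod.map (Projectivization.mk' ℂ) (Projectivization.mk' ℂ)) ⁻¹'
        {p : Conic × Conic | Admissible p.1.rep p.2.rep} =
        (fun q : {v : Fin (5 + 1) → ℂ // v ≠ 0} × {v : Fin (5 + 1) → ℂ // v ≠ 0} =>
          (q.1.1, q.2.1)) ⁻¹' {p | Admissible p.1 p.2} := by
      ext q
      exact admissible_rep_iff q.1.1 q.2.1 q.1.2 q.2.2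
    rw [this]
    exact isOpen_admissible.preimage (by fun_prop)

/-! ## Simultaneous diagonalization -/

theorem dot_mulVec_comm {C : Matrix (Fin 3) (Fin 3) ℂ} (hC : Cᵀ = C) (u w : Fin 3 → ℂ) :
    u ⬝ᵥ C *ᵥ w = w ⬝ᵥ C *ᵥ u := by
  rw [Matrix.dotProduct_mulVec, ← Matrix.mulVec_transpose, hC, dotProduct_comm]

theorem Transverse.anisotropic {C D : Matrix (Fin 3) (Fin 3) ℂ} (h : Transverse C D)
    {v : Fin 3 → ℂ} (hv : v ≠ 0) {μ : ℂ} (hμ : D *ᵥ v = μ • (C *ᵥ v)) : v ⬝ᵥ C *ᵥ v ≠ 0 := by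
  intro h0
  have := h v hv h0 (by rw [hμ, dotProduct_smul, h0, smul_zero])
  rw [← crossProduct_ne_zero_iff_linearIndependent] at this
  exact this (by rw [hμ]; simp)

theorem exists_eigenvector_mem {C D : Matrix (Fin 3) (Fin 3) ℂ} (h0 : C.det ≠ 0)
    (S : Submodule ℂ (Fin 3 → ℂ)) (hS : S ≠ ⊥)
    (hinv : ∀ u w : Fin 3 → ℂ, u ∈ S → C *ᵥ w = D *ᵥ u → w ∈ S) :
    ∃ v ∈ S, v ≠ 0 ∧ ∃ μ : ℂ, D *ᵥ v = μ • (C *ᵥ v) := by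
  have hu : IsUnit C.det := h0.isUnit
  let T : Module.End ℂ (Fin 3 → ℂ) := (C⁻¹ * D).mulVecLin
  have hCT : ∀ u, C *ᵥ (T u) = D *ᵥ u := fun u => by
    simp [T, Matrix.mulVec_mulVec, ← mul_assoc, Matrix.mul_nonsing_inv _ hu]
  have hT : ∀ u ∈ S, T u ∈ S := fun u hu' => hinv u _ hu' (hCT u)
  have : Nontrivial S := Submodule.nontrivial_iff_ne_bot.2 hS
  obtain ⟨μ, hμ⟩ := Module.End.exists_eigenvalue (T.restrict hT)
  obtain ⟨v, hv⟩ := hμ.exists_hasEigenvector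
  refine ⟨v, v.2, fun h => hv.2 (Subtype.ext h), μ, ?_⟩
  have := congrArg Subtype.val hv.apply_eq_smul
  simp only [LinearMap.coe_restrict_apply, SetLike.val_smul] at this
  rw [← hCT, this, Matrix.mulVec_smul]

theorem exists_diagonalization {C D : Matrix (Fin 3) (Fin 3) ℂ} (hC : Cᵀ = C) (hD : Dᵀ = D)
    (h0 : C.det ≠ 0) (ht : Transverse C D) :
    ∃ (V : Matrix (Fin 3) (Fin 3) ℂ) (l : Fin 3 → ℂ), Vᵀ * C * V = 1 ∧
      Vᵀ * D * V = Matrix.diagonal (fun i => -l i) ∧ Function.Injective l := by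
  -- the form `w ↦ w ⬝ C v`
  let f : (Fin 3 → ℂ) → ((Fin 3 → ℂ) →ₗ[ℂ] ℂ) := fun v =>
    { toFun := fun w => w ⬝ᵥ C *ᵥ v
      map_add' := fun a b => add_dotProduct _ _ _
      map_smul' := fun a b => smul_dotProduct _ _ _ }
  have hf : ∀ {v : Fin 3 → ℂ} {μ : ℂ}, D *ᵥ v = μ • (C *ᵥ v) → ∀ u w : Fin 3 → ℂ,
      f v u = 0 → C *ᵥ w = D *ᵥ u → f v w = 0 := by
    intro v μ hv u w hu hw
    change w ⬝ᵥ C *ᵥ v = 0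
    rw [dot_mulVec_comm hC, hw, dot_mulVec_comm hD, hv, dotProduct_smul]
    change μ • f v u = 0
    rw [hu, smul_zero]
  obtain ⟨v1, -, n1, μ1, e1⟩ := exists_eigenvector_mem (D := D) h0 ⊤ top_ne_bot
    (fun _ _ _ _ => Submodule.mem_top)
  obtain ⟨v2, m2, n2, μ2, e2⟩ := exists_eigenvector_mem (D := D) h0 (LinearMap.ker (f v1))
    (LinearMap.ker_ne_bot_of_finrank_lt (by simp))
    (fun u w hu hw => hf e1 u w hu hw)
  have hmem : ∀ w, w ∈ LinearMap.ker ((f v1).prod (f v2)) ↔ f v1 w = 0 ∧ f v2 w = 0 :=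
    fun w => Prod.ext_iff
  obtain ⟨v3, m3, n3, μ3, e3⟩ := exists_eigenvector_mem (D := D) h0
    (LinearMap.ker ((f v1).prod (f v2)))
    (LinearMap.ker_ne_bot_of_finrank_lt (by simp))
    (fun u w hu hw => (hmem w).2
      ⟨hf e1 u w ((hmem u).1 hu).1 hw, hf e2 u w ((hmem u).1 hu).2 hw⟩)
  have o21 : v2 ⬝ᵥ C *ᵥ v1 = 0 := m2
  have o31 : v3 ⬝ᵥ C *ᵥ v1 = 0 := ((hmem v3).1 m3).1
  have o32 : v3 ⬝ᵥ C *ᵥ v2 = 0 := ((hmem v3).1 m3).2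
  have o12 : v1 ⬝ᵥ C *ᵥ v2 = 0 := by rw [dot_mulVec_comm hC, o21]
  have o13 : v1 ⬝ᵥ C *ᵥ v3 = 0 := by rw [dot_mulVec_comm hC, o31]
  have o23 : v2 ⬝ᵥ C *ᵥ v3 = 0 := by rw [dot_mulVec_comm hC, o32]
  let v : Fin 3 → (Fin 3 → ℂ) := ![v1, v2, v3]
  let μ : Fin 3 → ℂ := ![μ1, μ2, μ3]
  have hne : ∀ i, v i ≠ 0 := by intro i; fin_cases i <;> assumption
  have he : ∀ i, D *ᵥ v i = μ i • (C *ᵥ v i) := by intro i; fin_cases i <;> assumption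
  have ho : ∀ i j, i ≠ j → v i ⬝ᵥ C *ᵥ v j = 0 := by
    intro i j hij
    fin_cases i <;> fin_cases j <;> first | assumption | exact absurd rfl hij
  have hκ : ∀ i, v i ⬝ᵥ C *ᵥ v i ≠ 0 := fun i => ht.anisotropic (hne i) (he i)
  choose c hc using fun i => IsAlgClosed.exists_pow_nat_eq (v i ⬝ᵥ C *ᵥ v i) (n := 2) (by simp)
  have hc0 : ∀ i, c i ≠ 0 := fun i h => hκ i (by rw [← hc i, h]; simp)
  let u : Fin 3 → (Fin 3 → ℂ) := fun i => (c i)⁻¹ • v i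
  have hu0 : ∀ i, u i ≠ 0 := fun i => smul_ne_zero (inv_ne_zero (hc0 i)) (hne i)
  have hue : ∀ i, D *ᵥ u i = μ i • (C *ᵥ u i) := fun i => by
    simp only [u, Matrix.mulVec_smul, he i, smul_comm (μ i)]
  have huo : ∀ i j, u i ⬝ᵥ C *ᵥ u j = if i = j then 1 else 0 := by
    intro i j
    simp only [u, Matrix.mulVec_smul, smul_dotProduct, dotProduct_smul, smul_eq_mul]
    split_ifs with hij
    · subst hij
      rw [← hc i]
      field_simp [hc0 i]
    · rw [ho i j hij]
      simp
  have entry : ∀ (N : Matrix (Fin 3) (Fin 3) ℂ) (i j : Fin 3),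
      ((Matrix.of u) * N * (Matrix.of u)ᵀ) i j = u i ⬝ᵥ N *ᵥ u j := by
    intro N i j
    simp only [Matrix.mul_apply, Matrix.of_apply, Matrix.transpose_apply, dotProduct,
      Matrix.mulVec, Fin.sum_univ_three]
    ring
  clear_value u
  refine ⟨(Matrix.of u)ᵀ, fun i => -μ i, ?_, ?_, ?_⟩
  · ext i j
    rw [Matrix.transpose_transpose, entry, huo, Matrix.one_apply]
  · ext i j
    rw [Matrix.transpose_transpose, entry, hue, dotProduct_smul, huo, Matrix.diagonal_apply]
    split_ifs with hij
    · subst hij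
      simp
    · simp
  · intro i j hij
    by_contra hne'
    have hμ : μ i = μ j := neg_injective hij
    have hw : D *ᵥ (u i + Complex.I • u j) = μ i • (C *ᵥ (u i + Complex.I • u j)) := by
      rw [Matrix.mulVec_add, Matrix.mulVec_smul, hue, hue, ← hμ, Matrix.mulVec_add,
        Matrix.mulVec_smul, smul_add, smul_comm Complex.I]
    have hiso : (u i + Complex.I • u j) ⬝ᵥ C *ᵥ (u i + Complex.I • u j) = 0 := by
      simp only [Matrix.mulVec_add, Matrix.mulVec_smul, add_dotProduct, dotProduct_add,
        smul_dotProduct, dotProduct_smul, huo, smul_eq_mul]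
      simp [hne', Ne.symm hne']
    refine ht.anisotropic (fun h => ?_) hw hiso
    have h1 : u i ⬝ᵥ C *ᵥ (u i + Complex.I • u j) = 1 := by
      simp only [Matrix.mulVec_add, Matrix.mulVec_smul, dotProduct_add, dotProduct_smul, huo]
      simp [hne']
    rw [h] at h1
    simp at h1

/-! ## The pencil polynomial, its discriminant and the elliptic curve -/

/-- The polynomial `det(xC + D)`. -/
def pencil (C D : Matrix (Fin 3) (Fin 3) ℂ) : ℂ[X] :=
  ((X : ℂ[X]) • C.map Polynomial.C + D.map Polynomial.C).det

/-- The monic form `y² = x³ + ax² + bx + c` of the cubic curve `y² = det(xC + D)`. -/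
def pencilCurve (C D : Matrix (Fin 3) (Fin 3) ℂ) : WeierstrassCurve ℂ where
  a₁ := 0
  a₂ := (pencil C D).coeff 2 / (pencil C D).coeff 3
  a₃ := 0
  a₄ := (pencil C D).coeff 1 / (pencil C D).coeff 3
  a₆ := (pencil C D).coeff 0 / (pencil C D).coeff 3

/-- The discriminant of `x³ + ax² + bx + c`. -/
def cubicDisc (a b c : ℂ) : ℂ :=
  a ^ 2 * b ^ 2 - 4 * b ^ 3 - 4 * a ^ 3 * c - 27 * c ^ 2 + 18 * a * b * c

theorem pencilCurve_Δ (C D : Matrix (Fin 3) (Fin 3) ℂ) :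
    (pencilCurve C D).Δ =
      16 * cubicDisc (pencilCurve C D).a₂ (pencilCurve C D).a₄ (pencilCurve C D).a₆ := by
  simp only [WeierstrassCurve.Δ, WeierstrassCurve.b₂, WeierstrassCurve.b₄, WeierstrassCurve.b₆,
    WeierstrassCurve.b₈, pencilCurve, cubicDisc]
  ring

theorem pencil_eq (C D : Matrix (Fin 3) (Fin 3) ℂ) : pencil C D = Cubic.toPoly
    ⟨C.det, (Matrix.of ![C 0, C 1, D 2]).det + (Matrix.of ![C 0, D 1, C 2]).det +
        (Matrix.of ![D 0, C 1, C 2]).det,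
      (Matrix.of ![C 0, D 1, D 2]).det + (Matrix.of ![D 0, C 1, D 2]).det +
        (Matrix.of ![D 0, D 1, C 2]).det, D.det⟩ := by
  simp only [Cubic.toPoly, pencil, Matrix.det_fin_three, Matrix.add_apply, Matrix.smul_apply,
    Matrix.map_apply, smul_eq_mul, Matrix.of_apply, Matrix.cons_val, map_add, map_sub, map_mul]
  ring

theorem pencil_coeff_three (C D : Matrix (Fin 3) (Fin 3) ℂ) :
    (pencil C D).coeff 3 = C.det := by
  rw [pencil_eq, Cubic.coeff_eq_a]

theorem pencil_coeff_two (C D : Matrix (Fin 3) (Fin 3) ℂ) : (pencil C D).coeff 2 =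
    (Matrix.of ![C 0, C 1, D 2]).det + (Matrix.of ![C 0, D 1, C 2]).det +
      (Matrix.of ![D 0, C 1, C 2]).det := by
  rw [pencil_eq, Cubic.coeff_eq_b]

theorem pencil_coeff_one (C D : Matrix (Fin 3) (Fin 3) ℂ) : (pencil C D).coeff 1 =
    (Matrix.of ![C 0, D 1, D 2]).det + (Matrix.of ![D 0, C 1, D 2]).det +
      (Matrix.of ![D 0, D 1, C 2]).det := by
  rw [pencil_eq, Cubic.coeff_eq_c]

theorem pencil_coeff_zero (C D : Matrix (Fin 3) (Fin 3) ℂ) :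
    (pencil C D).coeff 0 = D.det := by
  rw [pencil_eq, Cubic.coeff_eq_d]

theorem det_smul_add_smul (C D : Matrix (Fin 3) (Fin 3) ℂ) (s t : ℂ) :
    (s • C + t • D).det = (pencil C D).coeff 3 * s ^ 3 + (pencil C D).coeff 2 * (s ^ 2 * t) +
      (pencil C D).coeff 1 * (s * t ^ 2) + (pencil C D).coeff 0 * t ^ 3 := by
  rw [pencil_coeff_three, pencil_coeff_two, pencil_coeff_one, pencil_coeff_zero]
  simp only [Matrix.det_fin_three, Matrix.add_apply, Matrix.smul_apply,
    smul_eq_mul, Matrix.of_apply, Matrix.cons_val]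
  ring

theorem cubic_form_ext {a b c d a' b' c' d' : ℂ}
    (h : ∀ s t : ℂ, a * s ^ 3 + b * (s ^ 2 * t) + c * (s * t ^ 2) + d * t ^ 3 =
      a' * s ^ 3 + b' * (s ^ 2 * t) + c' * (s * t ^ 2) + d' * t ^ 3) :
    a = a' ∧ b = b' ∧ c = c' ∧ d = d' := by
  have h1 := h 1 0
  have h2 := h 0 1
  have h3 := h 1 1
  have h4 := h 1 (-1)
  refine ⟨?_, ?_, ?_, ?_⟩
  · linear_combination h1
  · linear_combination (h3 - h4) / 2 - h2
  · linear_combination (h3 + h4) / 2 - h1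
  · linear_combination h2

theorem pencil_coeff_congr (C D A : Matrix (Fin 3) (Fin 3) ℂ) (α β : ℂ) :
    (pencil (α • (Aᵀ * C * A)) (β • (Aᵀ * D * A))).coeff 3 =
        A.det ^ 2 * α ^ 3 * (pencil C D).coeff 3 ∧
      (pencil (α • (Aᵀ * C * A)) (β • (Aᵀ * D * A))).coeff 2 =
        A.det ^ 2 * (α ^ 2 * β) * (pencil C D).coeff 2 ∧
      (pencil (α • (Aᵀ * C * A)) (β • (Aᵀ * D * A))).coeff 1 =
        A.det ^ 2 * (α * β ^ 2) * (pencil C D).coeff 1 ∧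
      (pencil (α • (Aᵀ * C * A)) (β • (Aᵀ * D * A))).coeff 0 =
        A.det ^ 2 * β ^ 3 * (pencil C D).coeff 0 := by
  refine cubic_form_ext fun s t => ?_
  rw [← det_smul_add_smul]
  have : s • α • (Aᵀ * C * A) + t • β • (Aᵀ * D * A) =
      Aᵀ * ((s * α) • C + (t * β) • D) * A := by
    simp [mul_add, add_mul, smul_smul]
  rw [this, Matrix.det_mul, Matrix.det_mul, Matrix.det_transpose, det_smul_add_smul]
  ring

/-- Under congruence and rescaling, the coefficients `(a, b, c)` change by the weighted action
`(ta, t²b, t³c)`. -/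
theorem pencilCurve_congr (C D A : Matrix (Fin 3) (Fin 3) ℂ) {α β : ℂ} (hα : α ≠ 0)
    (hA : A.det ≠ 0) (hC : C.det ≠ 0) :
    (pencilCurve (α • (Aᵀ * C * A)) (β • (Aᵀ * D * A))).a₂ =
        (β / α) * (pencilCurve C D).a₂ ∧
      (pencilCurve (α • (Aᵀ * C * A)) (β • (Aᵀ * D * A))).a₄ =
        (β / α) ^ 2 * (pencilCurve C D).a₄ ∧
      (pencilCurve (α • (Aᵀ * C * A)) (β • (Aᵀ * D * A))).a₆ =
        (β / α) ^ 3 * (pencilCurve C D).a₆ := by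
  obtain ⟨h3, h2, h1, h0⟩ := pencil_coeff_congr C D A α β
  have hC' : (pencil C D).coeff 3 ≠ 0 := by rwa [pencil_coeff_three]
  simp only [pencilCurve, h3, h2, h1, h0]
  refine ⟨?_, ?_, ?_⟩ <;> field_simp

theorem pencilCurve_smul (C D : Matrix (Fin 3) (Fin 3) ℂ) {α β : ℂ} (hα : α ≠ 0) :
    (pencilCurve (α • C) (β • D)).a₂ = (β / α) * (pencilCurve C D).a₂ ∧
      (pencilCurve (α • C) (β • D)).a₄ = (β / α) ^ 2 * (pencilCurve C D).a₄ ∧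
      (pencilCurve (α • C) (β • D)).a₆ = (β / α) ^ 3 * (pencilCurve C D).a₆ := by
  by_cases hC : C.det = 0
  · simp [pencilCurve, pencil_coeff_three, hC]
  · simpa using pencilCurve_congr C D 1 (α := α) (β := β) hα (by simp) hC

theorem pencilCurve_of_diagonalization {C D V : Matrix (Fin 3) (Fin 3) ℂ} {l : Fin 3 → ℂ}
    (hC : Vᵀ * C * V = 1) (hD : Vᵀ * D * V = Matrix.diagonal fun i => -l i) :
    V.det ≠ 0 ∧ (pencilCurve C D).a₂ = -(l 0 + l 1 + l 2) ∧
      (pencilCurve C D).a₄ = l 0 * l 1 + l 0 * l 2 + l 1 * l 2 ∧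
      (pencilCurve C D).a₆ = -(l 0 * l 1 * l 2) := by
  have hdet : V.det ^ 2 * C.det = 1 := by
    have := congrArg Matrix.det hC
    rw [Matrix.det_mul, Matrix.det_mul, Matrix.det_transpose, Matrix.det_one] at this
    linear_combination this
  have hV : V.det ≠ 0 := fun h => by simp [h] at hdet
  have hC0 : C.det ≠ 0 := fun h => by simp [h] at hdet
  obtain ⟨h2, h4, h6⟩ := pencilCurve_congr C D V (α := 1) (β := 1) one_ne_zero hV hC0
  simp only [one_smul, div_one, one_pow, one_mul, hC, hD] at h2 h4 h6
  refine ⟨hV, ?_, ?_, ?_⟩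
  · rw [← h2]
    simp [pencilCurve, pencil_coeff_three, pencil_coeff_two, Matrix.det_fin_three]
    ring
  · rw [← h4]
    simp [pencilCurve, pencil_coeff_three, pencil_coeff_one, Matrix.det_fin_three]
    ring
  · rw [← h6]
    simp [pencilCurve, pencil_coeff_three, pencil_coeff_zero, Fin.prod_univ_three]

theorem Admissible.cubicDisc_ne_zero {x y : Fin (5 + 1) → ℂ} (h : Admissible x y) :
    cubicDisc (pencilCurve (conicMatrix x) (conicMatrix y)).a₂
      (pencilCurve (conicMatrix x) (conicMatrix y)).a₄
      (pencilCurve (conicMatrix x) (conicMatrix y)).a₆ ≠ 0 := by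
  obtain ⟨V, l, hC, hD, hl⟩ := exists_diagonalization (conicMatrix_transpose x)
    (conicMatrix_transpose y) h.1 h.2.2
  obtain ⟨-, h2, h4, h6⟩ := pencilCurve_of_diagonalization hC hD
  have : cubicDisc (-(l 0 + l 1 + l 2)) (l 0 * l 1 + l 0 * l 2 + l 1 * l 2)
      (-(l 0 * l 1 * l 2)) = ((l 0 - l 1) * (l 0 - l 2) * (l 1 - l 2)) ^ 2 := by
    simp only [cubicDisc]
    ring
  rw [h2, h4, h6, this]
  exact pow_ne_zero _ (mul_ne_zero (mul_ne_zero (sub_ne_zero.2 (hl.ne (by decide)))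
    (sub_ne_zero.2 (hl.ne (by decide)))) (sub_ne_zero.2 (hl.ne (by decide))))

theorem Admissible.a₆_ne_zero {x y : Fin (5 + 1) → ℂ} (h : Admissible x y) :
    (pencilCurve (conicMatrix x) (conicMatrix y)).a₆ ≠ 0 := by
  simp only [pencilCurve, pencil_coeff_three, pencil_coeff_zero]
  exact div_ne_zero h.2.1 h.1

/-- The symmetric matrix of the first conic of a pair (for a choice of homogeneous coordinates). -/
def fstMatrix (p : conicPairs) : Matrix (Fin 3) (Fin 3) ℂ := conicMatrix p.1.1.rep

/-- The symmetric matrix of the second conic of a pair. -/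
def sndMatrix (p : conicPairs) : Matrix (Fin 3) (Fin 3) ℂ := conicMatrix p.1.2.rep

/-- The elliptic curve `y² = det(xC + D)` of a pair `(C, D)`. -/
def ellipticCurve (p : conicPairs) : WeierstrassCurve ℂ :=
  pencilCurve (fstMatrix p) (sndMatrix p)

instance (p : conicPairs) : (ellipticCurve p).IsElliptic where
  isUnit := by
    have h : Admissible p.1.1.rep p.1.2.rep := p.2
    rw [isUnit_iff_ne_zero, ellipticCurve, pencilCurve_Δ]
    exact mul_ne_zero (by norm_num) h.cubicDisc_ne_zero

/-- The `j`-invariant `j : 𝔒 → ℂ`. -/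
def jInv (p : conicPairs) : ℂ := (ellipticCurve p).j

/-! ## The moduli space `ℳ` -/

/-- `(C, D)` and `(C', D')` are equivalent if `C' ∼ AᵀCA` and `D' ∼ AᵀDA` for some invertible `A`,
where `∼` is equality up to a non-zero scalar. -/
def Congruent (p q : conicPairs) : Prop :=
  ∃ A : Matrix (Fin 3) (Fin 3) ℂ, A.det ≠ 0 ∧ ∃ α β : ℂ, α ≠ 0 ∧ β ≠ 0 ∧
    fstMatrix q = α • (Aᵀ * fstMatrix p * A) ∧ sndMatrix q = β • (Aᵀ * sndMatrix p * A)

def congruenceSetoid : Setoid conicPairs where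
  r := Congruent
  iseqv :=
    { refl := fun p => ⟨1, by simp, 1, 1, one_ne_zero, one_ne_zero, by simp, by simp⟩
      symm := by
        rintro p q ⟨A, hA, α, β, hα, hβ, h1, h2⟩
        have hu : IsUnit A.det := hA.isUnit
        have hinv : ∀ N : Matrix (Fin 3) (Fin 3) ℂ, A⁻¹ᵀ * (Aᵀ * N * A) * A⁻¹ = N := fun N => by
          have e1 : A⁻¹ᵀ * Aᵀ = 1 := by
            rw [← Matrix.transpose_mul, Matrix.mul_nonsing_inv _ hu, Matrix.transpose_one]
          calc A⁻¹ᵀ * (Aᵀ * N * A) * A⁻¹ = (A⁻¹ᵀ * Aᵀ) * N * (A * A⁻¹) := by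
                simp only [mul_assoc]
            _ = N := by rw [e1, Matrix.mul_nonsing_inv _ hu, one_mul, mul_one]
        refine ⟨A⁻¹, ?_, α⁻¹, β⁻¹, inv_ne_zero hα, inv_ne_zero hβ, ?_, ?_⟩
        · rw [Matrix.det_nonsing_inv, Ring.inverse_eq_inv']
          exact inv_ne_zero hA
        · rw [h1, Matrix.mul_smul, Matrix.smul_mul, smul_smul, inv_mul_cancel₀ hα, one_smul, hinv]
        · rw [h2, Matrix.mul_smul, Matrix.smul_mul, smul_smul, inv_mul_cancel₀ hβ, one_smul, hinv]
      trans := by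
        rintro p q r ⟨A, hA, α, β, hα, hβ, h1, h2⟩ ⟨B, hB, γ, δ, hγ, hδ, h3, h4⟩
        refine ⟨A * B, by simp [hA, hB], γ * α, δ * β, mul_ne_zero hγ hα, mul_ne_zero hδ hβ,
          ?_, ?_⟩
        · rw [h3, h1]
          simp only [Matrix.transpose_mul, Matrix.mul_smul, Matrix.smul_mul, smul_smul, mul_assoc]
        · rw [h4, h2]
          simp only [Matrix.transpose_mul, Matrix.mul_smul, Matrix.smul_mul, smul_smul,
            mul_assoc] }

/-- The moduli space `ℳ`: the space of orbits of `𝔒` under congruence, with the quotient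
topology. -/
def Moduli : Type := Quotient congruenceSetoid

instance : TopologicalSpace Moduli := inferInstanceAs (TopologicalSpace (Quotient congruenceSetoid))

/-- The canonical projection `π : 𝔒 → ℳ`. -/
def proj (p : conicPairs) : Moduli := Quotient.mk congruenceSetoid p

theorem isQuotientMap_proj : IsQuotientMap proj := isQuotientMap_quotient_mk'

/-! ## The complex structure of `ℳ`

The class of `(C, D)` is determined by the point `[a : b : c]` of the weighted projective space
`ℙ(1,2,3)`, where `det(xC + D)` is proportional to `x³ + ax² + bx + c`, that is, by the elementary
symmetric functions of the roots up to sign. Normalizing to `x³ + x² + ux + v` where `a ≠ 0` and to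
`x³ + ux² + vx + v` where `b ≠ 0` gives two holomorphic charts. They cover the complement of the
single point `a = b = 0` of `ℳ`, at which `ℙ(1,2,3)` has a quotient singularity. -/

/-- The coefficients `(a, b, c)` of the monic cubic proportional to `det(xC + D)`. -/
def coeffs (p : conicPairs) : ℂ × ℂ × ℂ :=
  ((ellipticCurve p).a₂, (ellipticCurve p).a₄, (ellipticCurve p).a₆)

/-- Equality in the weighted projective space `ℙ(1,2,3)`. -/
def WeightedEq (w w' : ℂ × ℂ × ℂ) : Prop :=
  ∃ t : ℂ, t ≠ 0 ∧ w' = (t * w.1, t ^ 2 * w.2.1, t ^ 3 * w.2.2)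

theorem WeightedEq.symm {w w' : ℂ × ℂ × ℂ} (h : WeightedEq w w') : WeightedEq w' w := by
  obtain ⟨t, ht, rfl⟩ := h
  refine ⟨t⁻¹, inv_ne_zero ht, ?_⟩
  ext <;> simp <;> field_simp

theorem WeightedEq.trans {w w' w'' : ℂ × ℂ × ℂ} (h : WeightedEq w w') (h' : WeightedEq w' w'') :
    WeightedEq w w'' := by
  obtain ⟨t, ht, rfl⟩ := h
  obtain ⟨s, hs, rfl⟩ := h'
  refine ⟨s * t, mul_ne_zero hs ht, ?_⟩
  ext <;> simp <;> ring

theorem coeffs_a₆_ne_zero (p : conicPairs) : (coeffs p).2.2 ≠ 0 :=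
  Admissible.a₆_ne_zero (x := p.1.1.rep) (y := p.1.2.rep) p.2

theorem coeffs_disc_ne_zero (p : conicPairs) :
    cubicDisc (coeffs p).1 (coeffs p).2.1 (coeffs p).2.2 ≠ 0 :=
  Admissible.cubicDisc_ne_zero (x := p.1.1.rep) (y := p.1.2.rep) p.2

theorem weightedEq_of_proj_eq {p q : conicPairs} (h : proj p = proj q) :
    WeightedEq (coeffs p) (coeffs q) := by
  obtain ⟨A, hA, α, β, hα, hβ, h1, h2⟩ := Quotient.exact h
  have hp : Admissible p.1.1.rep p.1.2.rep := p.2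
  obtain ⟨e2, e4, e6⟩ := pencilCurve_congr (fstMatrix p) (sndMatrix p) A (β := β) hα hA hp.1
  refine ⟨β / α, div_ne_zero hβ hα, ?_⟩
  rw [← h1, ← h2] at e2 e4 e6
  ext1
  · exact e2
  · ext1
    · exact e4
    · exact e6

theorem proj_eq_of_weightedEq {p q : conicPairs} (h : WeightedEq (coeffs p) (coeffs q)) :
    proj p = proj q := by
  obtain ⟨t, ht, h⟩ := h
  have hp : Admissible p.1.1.rep p.1.2.rep := p.2
  have hq : Admissible q.1.1.rep q.1.2.rep := q.2
  obtain ⟨V, l, hVC, hVD, hl⟩ := exists_diagonalization (conicMatrix_transpose p.1.1.rep)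
    (conicMatrix_transpose p.1.2.rep) hp.1 hp.2.2
  obtain ⟨W, k, hWC, hWD, hk⟩ := exists_diagonalization (conicMatrix_transpose q.1.1.rep)
    (conicMatrix_transpose q.1.2.rep) hq.1 hq.2.2
  obtain ⟨hV, v2, v4, v6⟩ := pencilCurve_of_diagonalization hVC hVD
  obtain ⟨hW, w2, w4, w6⟩ := pencilCurve_of_diagonalization hWC hWD
  have g2 : -(k 0 + k 1 + k 2) = t * -(l 0 + l 1 + l 2) := by
    rw [← w2, ← v2]
    exact congrArg Prod.fst h
  have g4 : k 0 * k 1 + k 0 * k 2 + k 1 * k 2 =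
      t ^ 2 * (l 0 * l 1 + l 0 * l 2 + l 1 * l 2) := by
    rw [← w4, ← v4]
    exact congrArg (fun w => w.2.1) h
  have g6 : -(k 0 * k 1 * k 2) = t ^ 3 * -(l 0 * l 1 * l 2) := by
    rw [← w6, ← v6]
    exact congrArg (fun w => w.2.2) h
  have hroot : ∀ i, ∃ j, k j = t * l i := by
    intro i
    have : (t * l i - k 0) * (t * l i - k 1) * (t * l i - k 2) = 0 := by
      have e : (t * l i - k 0) * (t * l i - k 1) * (t * l i - k 2) =
          t ^ 3 * ((l i - l 0) * (l i - l 1) * (l i - l 2)) := by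
        linear_combination (t * l i) ^ 2 * g2 + (t * l i) * g4 + g6
      rw [e]
      fin_cases i <;> simp
    rcases mul_eq_zero.1 this with h' | h'
    · rcases mul_eq_zero.1 h' with h' | h'
      · exact ⟨0, (sub_eq_zero.1 h').symm⟩
      · exact ⟨1, (sub_eq_zero.1 h').symm⟩
    · exact ⟨2, (sub_eq_zero.1 h').symm⟩
  choose σ hσ using hroot
  have hσi : Function.Injective σ := fun i j hij => hl <| mul_left_cancel₀ ht <| by
    rw [← hσ, ← hσ, hij]
  let U := W.submatrix id σ
  have sub : ∀ N : Matrix (Fin 3) (Fin 3) ℂ, Uᵀ * N * U = (Wᵀ * N * W).submatrix σ σ :=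
    fun N => by
      ext i j
      simp [U, Matrix.mul_apply]
  have hUC : Uᵀ * fstMatrix q * U = 1 := by
    rw [sub, fstMatrix, hWC, Matrix.submatrix_one _ hσi]
  have hUD : Uᵀ * sndMatrix q * U = t • (Vᵀ * sndMatrix p * V) := by
    rw [sub, sndMatrix, hWD, Matrix.submatrix_diagonal _ _ hσi, sndMatrix, hVD]
    ext i j
    simp only [Matrix.diagonal_apply, Matrix.smul_apply, Function.comp, hσ, smul_eq_mul]
    split_ifs <;> simp
  have hU : IsUnit U.det := by
    rw [isUnit_iff_ne_zero]
    intro h0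
    have := congrArg Matrix.det hUC
    simp [Matrix.det_mul, h0] at this
  have hinv : ∀ N : Matrix (Fin 3) (Fin 3) ℂ, U⁻¹ᵀ * (Uᵀ * N * U) * U⁻¹ = N := fun N => by
    have e1 : U⁻¹ᵀ * Uᵀ = 1 := by
      rw [← Matrix.transpose_mul, Matrix.mul_nonsing_inv _ hU, Matrix.transpose_one]
    calc U⁻¹ᵀ * (Uᵀ * N * U) * U⁻¹ = (U⁻¹ᵀ * Uᵀ) * N * (U * U⁻¹) := by
          simp only [mul_assoc]
      _ = N := by rw [e1, Matrix.mul_nonsing_inv _ hU, one_mul, mul_one]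
  refine Quotient.sound ⟨V * U⁻¹, ?_, 1, t, one_ne_zero, ht, ?_, ?_⟩
  · rw [Matrix.det_mul, Matrix.det_nonsing_inv, Ring.inverse_eq_inv']
    exact mul_ne_zero hV (inv_ne_zero hU.ne_zero)
  · rw [one_smul, ← hinv (fstMatrix q), hUC, ← hVC, Matrix.transpose_mul]
    simp only [mul_assoc, fstMatrix]
  · rw [← hinv (sndMatrix q), hUD, Matrix.transpose_mul]
    simp only [mul_assoc, Matrix.mul_smul, Matrix.smul_mul]

theorem proj_surjective : Function.Surjective proj := Quotient.mk_surjective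

theorem proj_out (m : Moduli) : proj (Quotient.out m) = m := Quotient.out_eq m

theorem weightedEq_out (p : conicPairs) : WeightedEq (coeffs (Quotient.out (proj p))) (coeffs p) :=
  weightedEq_of_proj_eq (proj_out _)

/-- A weighted-homogeneous function of degree `0` in `(a, b, c)` is continuous on `𝔒` wherever it is
a continuous function of `(a, b, c)`. -/
theorem continuousAt_coeffs {Y : Type*} [TopologicalSpace Y] (G : ℂ × ℂ × ℂ → Y)
    (hG : ∀ w w', WeightedEq w w' → G w = G w') (p : conicPairs)
    (hc : ContinuousAt G (coeffs p)) : ContinuousAt (fun q => G (coeffs q)) p := by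
  let E : (Fin (5 + 1) → ℂ) × (Fin (5 + 1) → ℂ) → ℂ × ℂ × ℂ := fun z =>
    ((pencilCurve (conicMatrix z.1) (conicMatrix z.2)).a₂,
      (pencilCurve (conicMatrix z.1) (conicMatrix z.2)).a₄,
      (pencilCurve (conicMatrix z.1) (conicMatrix z.2)).a₆)
  let f : Conic × Conic → Y := fun q => G (E (q.1.rep, q.2.rep))
  have hQ := (isOpenQuotientMap_mk' (n := 5)).prodMap (isOpenQuotientMap_mk' (n := 5))
  have hfQ : f ∘ (Prod.map (Projectivization.mk' ℂ) (Projectivization.mk' ℂ)) =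
      G ∘ E ∘ fun z => (z.1.1, z.2.1) := by
    funext z
    obtain ⟨a, ha, e1⟩ := exists_rep_smul z.1.1 z.1.2
    obtain ⟨b, hb, e2⟩ := exists_rep_smul z.2.1 z.2.2
    refine (hG _ _ ?_).symm
    refine ⟨b / a, div_ne_zero hb ha, ?_⟩
    obtain ⟨g2, g4, g6⟩ := pencilCurve_smul (conicMatrix z.1.1) (conicMatrix z.2.1) (β := b) ha
    simp only [Prod.map, Projectivization.mk'_eq_mk, E, e1, e2, conicMatrix_smul, g2, g4, g6]
    rfl
  have hp : Admissible p.1.1.rep p.1.2.rep := p.2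
  have hE : ContinuousAt E (p.1.1.rep, p.1.2.rep) := by
    have h1 : ContinuousAt (fun z : (Fin (5 + 1) → ℂ) × (Fin (5 + 1) → ℂ) =>
        (conicMatrix z.1).det) (p.1.1.rep, p.1.2.rep) :=
      (continuous_conicMatrix.comp continuous_fst).matrix_det.continuousAt
    have h2 : ∀ k ≤ 2, Continuous fun z : (Fin (5 + 1) → ℂ) × (Fin (5 + 1) → ℂ) =>
        (pencil (conicMatrix z.1) (conicMatrix z.2)).coeff k := by
      intro k hk
      interval_cases k <;>
        simp only [pencil_coeff_two, pencil_coeff_one, pencil_coeff_zero, conicMatrix,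
          Matrix.det_fin_three, Matrix.of_apply, Matrix.cons_val] <;> fun_prop
    have h3 : ∀ k ≤ 2, ContinuousAt (fun z : (Fin (5 + 1) → ℂ) × (Fin (5 + 1) → ℂ) =>
        (pencil (conicMatrix z.1) (conicMatrix z.2)).coeff k /
          (pencil (conicMatrix z.1) (conicMatrix z.2)).coeff 3) (p.1.1.rep, p.1.2.rep) := by
      intro k hk
      simp only [pencil_coeff_three]
      exact (h2 k hk).continuousAt.div h1 hp.1
    exact (h3 2 le_rfl).prodMk ((h3 1 (by norm_num)).prodMk (h3 0 (by norm_num)))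
  have hf : ContinuousAt f p.1 := by
    have hz : Prod.map (Projectivization.mk' ℂ) (Projectivization.mk' ℂ)
        ((⟨p.1.1.rep, p.1.1.rep_nonzero⟩, ⟨p.1.2.rep, p.1.2.rep_nonzero⟩) :
          {v : Fin (5 + 1) → ℂ // v ≠ 0} × {v : Fin (5 + 1) → ℂ // v ≠ 0}) = p.1 := by
      simp [Prod.map]
    rw [← hz, ← hQ.continuousAt_comp_iff, hfQ]
    have h1 : ContinuousAt (fun z : {v : Fin (5 + 1) → ℂ // v ≠ 0} ×
        {v : Fin (5 + 1) → ℂ // v ≠ 0} => (z.1.1, z.2.1))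
        (⟨p.1.1.rep, p.1.1.rep_nonzero⟩, ⟨p.1.2.rep, p.1.2.rep_nonzero⟩) := by fun_prop
    have h2 : ContinuousAt (G ∘ E) (p.1.1.rep, p.1.2.rep) :=
      ContinuousAt.comp (f := E) (x := (p.1.1.rep, p.1.2.rep)) hc hE
    exact ContinuousAt.comp (g := G ∘ E) h2 h1
  exact ContinuousAt.comp (f := Subtype.val) (x := p) hf continuous_subtype_val.continuousAt

/-- Coordinates of two conics with `det(xC + D) = -(x³ + ax² + bx + c)`. -/
def modelFst (a b : ℂ) : Fin (5 + 1) → ℂ := ![b, a, 1, 1, 0, 0]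

/-- See `modelFst`. -/
def modelSnd (a c : ℂ) : Fin (5 + 1) → ℂ := ![c, 0, 0, -a, -1, 0]

theorem modelFst_ne_zero (a b : ℂ) : modelFst a b ≠ 0 := fun h => by
  have := congrFun h 2
  simp [modelFst] at this

theorem modelSnd_ne_zero (a c : ℂ) : modelSnd a c ≠ 0 := fun h => by
  have := congrFun h 4
  simp [modelSnd] at this

theorem conicMatrix_modelFst (a b : ℂ) :
    conicMatrix (modelFst a b) = !![b, a, 1; a, 1, 0; 1, 0, 0] := by
  simp [conicMatrix, modelFst]

theorem conicMatrix_modelSnd (a c : ℂ) :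
    conicMatrix (modelSnd a c) = !![c, 0, 0; 0, -a, -1; 0, -1, 0] := by
  simp [conicMatrix, modelSnd]

theorem admissible_model {a b c : ℂ} (hc : c ≠ 0) (hd : cubicDisc a b c ≠ 0) :
    Admissible (modelFst a b) (modelSnd a c) := by
  rw [Admissible, conicMatrix_modelFst, conicMatrix_modelSnd]
  refine ⟨?_, ?_, ?_⟩
  · simp [Matrix.det_fin_three]
  · simpa [Matrix.det_fin_three] using hc
  · intro v hv h1 h2
    rw [← crossProduct_ne_zero_iff_linearIndependent]
    intro h3
    have c0 := congrFun h3 0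
    have c1 := congrFun h3 1
    have c2 := congrFun h3 2
    simp [cross_apply, Matrix.mulVec, dotProduct, Fin.sum_univ_three] at c0 c1 c2 h1
    by_cases hv0 : v 0 = 0
    · have hv1 : v 1 = 0 := by
        rw [hv0] at c0
        simpa using c0
      have hv2 : v 2 = 0 := by
        rw [hv0, hv1] at c2
        simpa using c2
      apply hv
      funext i
      fin_cases i <;> simp [hv0, hv1, hv2]
    · apply hd
      obtain ⟨r, hr⟩ : ∃ r, v 1 = r * v 0 := ⟨v 1 / v 0, by field_simp⟩
      have e2 : v 2 = r ^ 2 * v 0 := by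
        apply mul_left_cancel₀ hv0
        rw [hr] at c0
        linear_combination c0
      rw [hr, e2] at c1 h1
      have eP : c + b * r + a * r ^ 2 + r ^ 3 = 0 := by
        apply mul_left_cancel₀ (pow_ne_zero 2 hv0)
        linear_combination c1
      have eP' : b + 2 * a * r + 3 * r ^ 2 = 0 := by
        apply mul_left_cancel₀ (pow_ne_zero 2 hv0)
        linear_combination h1
      have hb : b = -(2 * a * r + 3 * r ^ 2) := by linear_combination eP'
      have hc' : c = a * r ^ 2 + 2 * r ^ 3 := by linear_combination eP - r * eP'
      rw [hb, hc', cubicDisc]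
      ring

/-- A pair of conics for which `det(xC + D)` is proportional to `x³ + ax² + bx + c`. -/
def modelPair (a b c : ℂ) (h : c ≠ 0 ∧ cubicDisc a b c ≠ 0) : conicPairs :=
  ⟨(Projectivization.mk ℂ (modelFst a b) (modelFst_ne_zero a b),
    Projectivization.mk ℂ (modelSnd a c) (modelSnd_ne_zero a c)),
    (admissible_rep_iff _ _ _ _).2 (admissible_model h.1 h.2)⟩

theorem coeffs_modelPair (a b c : ℂ) (h : c ≠ 0 ∧ cubicDisc a b c ≠ 0) :
    WeightedEq (a, b, c) (coeffs (modelPair a b c h)) := by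
  obtain ⟨s, hs, e1⟩ := exists_rep_smul (modelFst a b) (modelFst_ne_zero a b)
  obtain ⟨t, ht, e2⟩ := exists_rep_smul (modelSnd a c) (modelSnd_ne_zero a c)
  obtain ⟨g2, g4, g6⟩ := pencilCurve_smul (conicMatrix (modelFst a b))
    (conicMatrix (modelSnd a c)) (β := t) hs
  refine ⟨t / s, div_ne_zero ht hs, ?_⟩
  simp only [coeffs, ellipticCurve, fstMatrix, sndMatrix, modelPair, e1, e2, conicMatrix_smul,
    g2, g4, g6]
  rw [conicMatrix_modelFst, conicMatrix_modelSnd]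
  simp [pencilCurve, pencil_coeff_three, pencil_coeff_two, pencil_coeff_one, pencil_coeff_zero,
    Matrix.det_fin_three]

theorem continuousOn_proj_modelPair {s : Set (ℂ × ℂ)} (a b c : ℂ × ℂ → ℂ) (d : Moduli)
    [∀ z, Decidable (c z ≠ 0 ∧ cubicDisc (a z) (b z) (c z) ≠ 0)]
    (ha : Continuous a) (hb : Continuous b) (hc : Continuous c)
    (hs : ∀ z ∈ s, c z ≠ 0 ∧ cubicDisc (a z) (b z) (c z) ≠ 0) :
    ContinuousOn (fun z => if h : c z ≠ 0 ∧ cubicDisc (a z) (b z) (c z) ≠ 0 then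
      proj (modelPair (a z) (b z) (c z) h) else d) s := by
  rw [continuousOn_iff_continuous_domRestrict]
  have : Set.domRestrict s (fun z => if h : c z ≠ 0 ∧ cubicDisc (a z) (b z) (c z) ≠ 0 then
      proj (modelPair (a z) (b z) (c z) h) else d) =
      fun z : s => proj (modelPair (a z) (b z) (c z) (hs z z.2)) := by
    funext z
    exact dif_pos (hs z z.2)
  rw [this]
  refine isQuotientMap_proj.continuous.comp (Continuous.subtype_mk (Continuous.prodMk ?_ ?_) _)
  · refine isQuotientMap_mk'.continuous.comp (Continuous.subtype_mk ?_ _)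
    refine continuous_pi fun i => ?_
    fin_cases i <;> simp [modelFst] <;> fun_prop
  · refine isQuotientMap_mk'.continuous.comp (Continuous.subtype_mk ?_ _)
    refine continuous_pi fun i => ?_
    fin_cases i <;> simp [modelSnd] <;> fun_prop

theorem isOpen_coeffs_ne_zero :
    IsOpen {m : Moduli | (coeffs (Quotient.out m)).1 ≠ 0} ∧
      IsOpen {m : Moduli | (coeffs (Quotient.out m)).2.1 ≠ 0} := by
  constructor
  · rw [← isQuotientMap_proj.isOpen_preimage]
    have e : proj ⁻¹' {m : Moduli | (coeffs (Quotient.out m)).1 ≠ 0} =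
        (fun p => (coeffs p).1 ^ 3 / (coeffs p).2.2) ⁻¹' {0}ᶜ := by
      ext p
      obtain ⟨t, ht, h⟩ := weightedEq_out p
      simp [h, ht, coeffs_a₆_ne_zero]
    rw [e]
    refine isOpen_compl_singleton.preimage (continuous_iff_continuousAt.2 fun p => ?_)
    refine continuousAt_coeffs (fun w => w.1 ^ 3 / w.2.2) ?_ p ?_
    · rintro w _ ⟨t, ht, rfl⟩
      simp only [mul_pow]
      field_simp
    · exact ContinuousAt.div (by fun_prop) (by fun_prop) (coeffs_a₆_ne_zero p)
  · rw [← isQuotientMap_proj.isOpen_preimage]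
    have e : proj ⁻¹' {m : Moduli | (coeffs (Quotient.out m)).2.1 ≠ 0} =
        (fun p => (coeffs p).2.1 ^ 3 / (coeffs p).2.2 ^ 2) ⁻¹' {0}ᶜ := by
      ext p
      obtain ⟨t, ht, h⟩ := weightedEq_out p
      simp [h, ht, coeffs_a₆_ne_zero]
    rw [e]
    refine isOpen_compl_singleton.preimage (continuous_iff_continuousAt.2 fun p => ?_)
    refine continuousAt_coeffs (fun w => w.2.1 ^ 3 / w.2.2 ^ 2) ?_ p ?_
    · rintro w _ ⟨t, ht, rfl⟩
      simp only [mul_pow]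
      field_simp
    · exact ContinuousAt.div (by fun_prop) (by fun_prop) (pow_ne_zero _ (coeffs_a₆_ne_zero p))

theorem isOpen_moduliChart_target (a b c : ℂ × ℂ → ℂ)
    (ha : Continuous a) (hb : Continuous b) (hc : Continuous c) :
    IsOpen {z : ℂ × ℂ | c z ≠ 0 ∧ cubicDisc (a z) (b z) (c z) ≠ 0} := by
  refine (isOpen_ne_fun hc continuous_const).inter (isOpen_ne_fun ?_ continuous_const)
  simp only [cubicDisc]
  fun_prop

/-- An arbitrary point of `ℳ`, used as a default value only. -/
def basePoint : Moduli := proj (modelPair 0 0 1 (by norm_num [cubicDisc]))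

open Classical in
/-- The chart `[a : b : c] ↦ (b / a², c / a³)` of `ℳ` on `{a ≠ 0}`; its inverse sends `(u, v)` to
the class of pairs with `det(xC + D)` proportional to `x³ + x² + ux + v`. -/
def moduliChart₁ : OpenPartialHomeomorph Moduli (ℂ × ℂ) where
  toFun m := ((coeffs (Quotient.out m)).2.1 / (coeffs (Quotient.out m)).1 ^ 2,
    (coeffs (Quotient.out m)).2.2 / (coeffs (Quotient.out m)).1 ^ 3)
  invFun z := if h : z.2 ≠ 0 ∧ cubicDisc 1 z.1 z.2 ≠ 0 then proj (modelPair 1 z.1 z.2 h)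
    else basePoint
  source := {m | (coeffs (Quotient.out m)).1 ≠ 0}
  target := {z | z.2 ≠ 0 ∧ cubicDisc 1 z.1 z.2 ≠ 0}
  map_source' m hm := by
    have hm' : (coeffs (Quotient.out m)).1 ≠ 0 := hm
    refine ⟨div_ne_zero (coeffs_a₆_ne_zero _) (pow_ne_zero _ hm'), fun h => ?_⟩
    apply coeffs_disc_ne_zero (Quotient.out m)
    simp only [cubicDisc] at h ⊢
    field_simp at h
    linear_combination h
  map_target' z hz := by
    have hz' : z.2 ≠ 0 ∧ cubicDisc 1 z.1 z.2 ≠ 0 := hz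
    obtain ⟨t, ht, h⟩ := (coeffs_modelPair 1 z.1 z.2 hz').trans (weightedEq_out _).symm
    rw [dif_pos hz', Set.mem_ofPred_eq, h]
    simpa using ht
  left_inv' m hm := by
    have hm' : (coeffs (Quotient.out m)).1 ≠ 0 := hm
    have hz : (coeffs (Quotient.out m)).2.2 / (coeffs (Quotient.out m)).1 ^ 3 ≠ 0 ∧
        cubicDisc 1 ((coeffs (Quotient.out m)).2.1 / (coeffs (Quotient.out m)).1 ^ 2)
          ((coeffs (Quotient.out m)).2.2 / (coeffs (Quotient.out m)).1 ^ 3) ≠ 0 := by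
      refine ⟨div_ne_zero (coeffs_a₆_ne_zero _) (pow_ne_zero _ hm'), fun h => ?_⟩
      apply coeffs_disc_ne_zero (Quotient.out m)
      simp only [cubicDisc] at h ⊢
      field_simp at h
      linear_combination h
    rw [dif_pos hz]
    conv_rhs => rw [← proj_out m]
    refine proj_eq_of_weightedEq ((coeffs_modelPair _ _ _ hz).symm.trans
      ⟨(coeffs (Quotient.out m)).1, hm', ?_⟩)
    ext <;> simp <;> field_simp
  right_inv' z hz := by
    have hz' : z.2 ≠ 0 ∧ cubicDisc 1 z.1 z.2 ≠ 0 := hz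
    obtain ⟨t, ht, h⟩ := (coeffs_modelPair 1 z.1 z.2 hz').trans (weightedEq_out _).symm
    rw [dif_pos hz', h]
    ext <;> simp <;> field_simp
  open_source := isOpen_coeffs_ne_zero.1
  open_target := isOpen_moduliChart_target (fun _ => 1) (fun z => z.1) (fun z => z.2)
    (by fun_prop) (by fun_prop) (by fun_prop)
  continuousOn_toFun := by
    rw [isQuotientMap_proj.continuousOn_isOpen_iff isOpen_coeffs_ne_zero.1]
    have hG : ∀ w w' : ℂ × ℂ × ℂ, WeightedEq w w' →
        ((w.2.1 / w.1 ^ 2, w.2.2 / w.1 ^ 3) : ℂ × ℂ) = (w'.2.1 / w'.1 ^ 2, w'.2.2 / w'.1 ^ 3) := by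
      rintro w _ ⟨t, ht, rfl⟩
      ext <;> simp only [mul_pow] <;> field_simp
    intro p hp
    have e : (fun m : Moduli => (((coeffs (Quotient.out m)).2.1 / (coeffs (Quotient.out m)).1 ^ 2,
        (coeffs (Quotient.out m)).2.2 / (coeffs (Quotient.out m)).1 ^ 3) : ℂ × ℂ)) ∘ proj =
        fun p => ((coeffs p).2.1 / (coeffs p).1 ^ 2, (coeffs p).2.2 / (coeffs p).1 ^ 3) := by
      funext q
      exact hG _ _ (weightedEq_out q)
    have hp' : (coeffs p).1 ≠ 0 := by
      obtain ⟨t, ht, h⟩ := weightedEq_out p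
      rw [h]
      exact mul_ne_zero ht hp
    rw [e]
    refine (continuousAt_coeffs (fun w => (w.2.1 / w.1 ^ 2, w.2.2 / w.1 ^ 3)) hG p
      ?_).continuousWithinAt
    have c1 : ContinuousAt (fun w : ℂ × ℂ × ℂ => w.2.1 / w.1 ^ 2) (coeffs p) :=
      ContinuousAt.div (by fun_prop) (by fun_prop) (pow_ne_zero _ hp')
    have c2 : ContinuousAt (fun w : ℂ × ℂ × ℂ => w.2.2 / w.1 ^ 3) (coeffs p) :=
      ContinuousAt.div (by fun_prop) (by fun_prop) (pow_ne_zero _ hp')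
    exact c1.prodMk c2
  continuousOn_invFun := continuousOn_proj_modelPair (fun _ => 1) (fun z => z.1) (fun z => z.2) _
    (by fun_prop) (by fun_prop) (by fun_prop) fun _ hz => hz

open Classical in
/-- The chart `[a : b : c] ↦ (ab / c, b³ / c²)` of `ℳ` on `{b ≠ 0}`; its inverse sends `(u, v)` to
the class of pairs with `det(xC + D)` proportional to `x³ + ux² + vx + v`. -/
def moduliChart₂ : OpenPartialHomeomorph Moduli (ℂ × ℂ) where
  toFun m := ((coeffs (Quotient.out m)).1 * (coeffs (Quotient.out m)).2.1 /
      (coeffs (Quotient.out m)).2.2,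
    (coeffs (Quotient.out m)).2.1 ^ 3 / (coeffs (Quotient.out m)).2.2 ^ 2)
  invFun z := if h : z.2 ≠ 0 ∧ cubicDisc z.1 z.2 z.2 ≠ 0 then proj (modelPair z.1 z.2 z.2 h)
    else basePoint
  source := {m | (coeffs (Quotient.out m)).2.1 ≠ 0}
  target := {z | z.2 ≠ 0 ∧ cubicDisc z.1 z.2 z.2 ≠ 0}
  map_source' m hm := by
    have hm' : (coeffs (Quotient.out m)).2.1 ≠ 0 := hm
    have h6 := coeffs_a₆_ne_zero (Quotient.out m)
    refine ⟨div_ne_zero (pow_ne_zero _ hm') (pow_ne_zero _ h6), fun h => ?_⟩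
    apply coeffs_disc_ne_zero (Quotient.out m)
    simp only [cubicDisc] at h ⊢
    field_simp at h
    apply mul_left_cancel₀ (pow_ne_zero 6 hm')
    linear_combination h
  map_target' z hz := by
    have hz' : z.2 ≠ 0 ∧ cubicDisc z.1 z.2 z.2 ≠ 0 := hz
    obtain ⟨t, ht, h⟩ := (coeffs_modelPair z.1 z.2 z.2 hz').trans (weightedEq_out _).symm
    rw [dif_pos hz', Set.mem_ofPred_eq, h]
    simpa [ht] using hz'.1
  left_inv' m hm := by
    have hm' : (coeffs (Quotient.out m)).2.1 ≠ 0 := hm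
    have h6 := coeffs_a₆_ne_zero (Quotient.out m)
    have hz : (coeffs (Quotient.out m)).2.1 ^ 3 / (coeffs (Quotient.out m)).2.2 ^ 2 ≠ 0 ∧
        cubicDisc ((coeffs (Quotient.out m)).1 * (coeffs (Quotient.out m)).2.1 /
            (coeffs (Quotient.out m)).2.2)
          ((coeffs (Quotient.out m)).2.1 ^ 3 / (coeffs (Quotient.out m)).2.2 ^ 2)
          ((coeffs (Quotient.out m)).2.1 ^ 3 / (coeffs (Quotient.out m)).2.2 ^ 2) ≠ 0 := by
      refine ⟨div_ne_zero (pow_ne_zero _ hm') (pow_ne_zero _ h6), fun h => ?_⟩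
      apply coeffs_disc_ne_zero (Quotient.out m)
      simp only [cubicDisc] at h ⊢
      field_simp at h
      apply mul_left_cancel₀ (pow_ne_zero 6 hm')
      linear_combination h
    rw [dif_pos hz]
    conv_rhs => rw [← proj_out m]
    refine proj_eq_of_weightedEq ((coeffs_modelPair _ _ _ hz).symm.trans
      ⟨(coeffs (Quotient.out m)).2.2 / (coeffs (Quotient.out m)).2.1, div_ne_zero h6 hm', ?_⟩)
    ext <;> simp <;> field_simp
  right_inv' z hz := by
    have hz' : z.2 ≠ 0 ∧ cubicDisc z.1 z.2 z.2 ≠ 0 := hz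
    have h2 : z.2 ≠ 0 := hz'.1
    obtain ⟨t, ht, h⟩ := (coeffs_modelPair z.1 z.2 z.2 hz').trans (weightedEq_out _).symm
    rw [dif_pos hz', h]
    ext <;> simp <;> field_simp
  open_source := isOpen_coeffs_ne_zero.2
  open_target := isOpen_moduliChart_target (fun z => z.1) (fun z => z.2) (fun z => z.2)
    (by fun_prop) (by fun_prop) (by fun_prop)
  continuousOn_toFun := by
    rw [isQuotientMap_proj.continuousOn_isOpen_iff isOpen_coeffs_ne_zero.2]
    have hG : ∀ w w' : ℂ × ℂ × ℂ, WeightedEq w w' →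
        ((w.1 * w.2.1 / w.2.2, w.2.1 ^ 3 / w.2.2 ^ 2) : ℂ × ℂ) =
          (w'.1 * w'.2.1 / w'.2.2, w'.2.1 ^ 3 / w'.2.2 ^ 2) := by
      rintro w _ ⟨t, ht, rfl⟩
      ext <;> simp only [mul_pow] <;> field_simp
    intro p hp
    have e : (fun m : Moduli => (((coeffs (Quotient.out m)).1 * (coeffs (Quotient.out m)).2.1 /
        (coeffs (Quotient.out m)).2.2,
        (coeffs (Quotient.out m)).2.1 ^ 3 / (coeffs (Quotient.out m)).2.2 ^ 2) : ℂ × ℂ)) ∘ proj =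
        fun p => ((coeffs p).1 * (coeffs p).2.1 / (coeffs p).2.2,
          (coeffs p).2.1 ^ 3 / (coeffs p).2.2 ^ 2) := by
      funext q
      exact hG _ _ (weightedEq_out q)
    have h6 := coeffs_a₆_ne_zero p
    rw [e]
    refine (continuousAt_coeffs (fun w => (w.1 * w.2.1 / w.2.2, w.2.1 ^ 3 / w.2.2 ^ 2)) hG p
      ?_).continuousWithinAt
    have c1 : ContinuousAt (fun w : ℂ × ℂ × ℂ => w.1 * w.2.1 / w.2.2) (coeffs p) :=
      ContinuousAt.div (by fun_prop) (by fun_prop) h6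
    have c2 : ContinuousAt (fun w : ℂ × ℂ × ℂ => w.2.1 ^ 3 / w.2.2 ^ 2) (coeffs p) :=
      ContinuousAt.div (by fun_prop) (by fun_prop) (pow_ne_zero _ h6)
    exact c1.prodMk c2
  continuousOn_invFun := continuousOn_proj_modelPair (fun z => z.1) (fun z => z.2) (fun z => z.2) _
    (by fun_prop) (by fun_prop) (by fun_prop) fun _ hz => hz

/-- The smooth part of `ℳ`: the complement of the point with `a = b = 0`, i.e. of the special orbit,
formed by the pairs for which the roots of `det(xC + D)` are proportional to the three cube roots
of unity. -/
def regularLocus : TopologicalSpace.Opens Moduli where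
  carrier := {m | (coeffs (Quotient.out m)).1 ≠ 0 ∨ (coeffs (Quotient.out m)).2.1 ≠ 0}
  is_open' := isOpen_coeffs_ne_zero.1.union isOpen_coeffs_ne_zero.2

theorem proj_mem_regularLocus_iff (p : conicPairs) :
    proj p ∈ regularLocus ↔ (ellipticCurve p).a₂ ≠ 0 ∨ (ellipticCurve p).a₄ ≠ 0 := by
  obtain ⟨t, ht, h⟩ := (weightedEq_out p).symm
  change (coeffs _).1 ≠ 0 ∨ (coeffs _).2.1 ≠ 0 ↔ (coeffs p).1 ≠ 0 ∨ (coeffs p).2.1 ≠ 0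
  simp [h, ht]

instance : Nonempty regularLocus :=
  ⟨⟨proj (modelPair 1 0 1 (by norm_num [cubicDisc])), (proj_mem_regularLocus_iff _).2 <| by
    obtain ⟨t, ht, h⟩ := coeffs_modelPair 1 0 1 (by norm_num [cubicDisc])
    left
    change (coeffs _).1 ≠ 0
    rw [h]
    simpa using ht⟩⟩

open Classical in
/-- The complex atlas of the smooth part of `ℳ`. -/
instance moduliChartedSpace : ChartedSpace (ℂ × ℂ) regularLocus where
  atlas := {moduliChart₁.subtypeRestr inferInstance, moduliChart₂.subtypeRestr inferInstance}
  chartAt m := if (coeffs (Quotient.out m.1)).1 ≠ 0 then moduliChart₁.subtypeRestr inferInstance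
    else moduliChart₂.subtypeRestr inferInstance
  mem_chart_source m := by
    split_ifs with h
    · rw [OpenPartialHomeomorph.subtypeRestr_source]
      exact h
    · rw [OpenPartialHomeomorph.subtypeRestr_source]
      exact m.2.resolve_left h
  chart_mem_atlas m := by
    split_ifs
    · exact Set.mem_insert _ _
    · exact Set.mem_insert_of_mem _ rfl

theorem moduliChart₁_trans_source (z : ℂ × ℂ)
    (hz : z ∈ (moduliChart₁.symm.trans moduliChart₂).source) : z.1 ≠ 0 ∧
      moduliChart₁.symm.trans moduliChart₂ z = (z.1 / z.2, z.1 ^ 3 / z.2 ^ 2) := by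
  rw [OpenPartialHomeomorph.trans_source] at hz
  have hz' : z.2 ≠ 0 ∧ cubicDisc 1 z.1 z.2 ≠ 0 := hz.1
  obtain ⟨t, ht, h⟩ := (coeffs_modelPair 1 z.1 z.2 hz').trans (weightedEq_out _).symm
  have e : moduliChart₁.symm z = proj (modelPair 1 z.1 z.2 hz') := dif_pos hz'
  have h2 : (coeffs (Quotient.out (moduliChart₁.symm z))).2.1 ≠ 0 := hz.2
  rw [e, h] at h2
  refine ⟨right_ne_zero_of_mul h2, ?_⟩
  rw [OpenPartialHomeomorph.coe_trans, Function.comp, e]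
  have := hz'.1
  change ((_ / _, _ / _) : ℂ × ℂ) = _
  rw [h]
  ext <;> simp only [mul_pow] <;> field_simp

theorem moduliChart₂_trans_source (z : ℂ × ℂ)
    (hz : z ∈ (moduliChart₂.symm.trans moduliChart₁).source) : z.1 ≠ 0 ∧
      moduliChart₂.symm.trans moduliChart₁ z = (z.2 / z.1 ^ 2, z.2 / z.1 ^ 3) := by
  rw [OpenPartialHomeomorph.trans_source] at hz
  have hz' : z.2 ≠ 0 ∧ cubicDisc z.1 z.2 z.2 ≠ 0 := hz.1
  obtain ⟨t, ht, h⟩ := (coeffs_modelPair z.1 z.2 z.2 hz').trans (weightedEq_out _).symm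
  have e : moduliChart₂.symm z = proj (modelPair z.1 z.2 z.2 hz') := dif_pos hz'
  have h2 : (coeffs (Quotient.out (moduliChart₂.symm z))).1 ≠ 0 := hz.2
  rw [e, h] at h2
  have h1 : z.1 ≠ 0 := right_ne_zero_of_mul h2
  refine ⟨h1, ?_⟩
  rw [OpenPartialHomeomorph.coe_trans, Function.comp, e]
  change ((_ / _, _ / _) : ℂ × ℂ) = _
  rw [h]
  ext <;> simp only [mul_pow] <;> field_simp

theorem moduliChart_compatible {e e' : OpenPartialHomeomorph Moduli (ℂ × ℂ)}
    (he : ContDiffOn ℂ ω (e.symm.trans e') (e.symm.trans e').source)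
    (he' : ContDiffOn ℂ ω (e'.symm.trans e) (e'.symm.trans e).source) :
    (e.subtypeRestr (s := regularLocus) inferInstance).symm.trans
      (e'.subtypeRestr (s := regularLocus) inferInstance) ∈ contDiffGroupoid ω 𝓘(ℂ, ℂ × ℂ) := by
  refine (contDiffGroupoid ω 𝓘(ℂ, ℂ × ℂ)).mem_of_eqOnSource (closedUnderRestriction' ?_
    (e.isOpen_inter_preimage_symm regularLocus.2)) (e.subtypeRestr_symm_trans_subtypeRestr _ e')
  rw [contDiffGroupoid, mem_groupoid_of_pregroupoid]
  constructor
  · simpa [contDiffPregroupoid] using he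
  · simpa [contDiffPregroupoid] using he'

instance moduliIsManifold : IsManifold 𝓘(ℂ, ℂ × ℂ) ω regularLocus := by
  have h12 : ContDiffOn ℂ ω (moduliChart₁.symm.trans moduliChart₂)
      (moduliChart₁.symm.trans moduliChart₂).source := by
    refine ContDiffOn.congr (f := fun z : ℂ × ℂ => (z.1 / z.2, z.1 ^ 3 / z.2 ^ 2)) ?_
      fun z hz => (moduliChart₁_trans_source z hz).2
    have hne : ∀ z ∈ (moduliChart₁.symm.trans moduliChart₂).source, z.2 ≠ 0 := fun z hz => hz.1.1
    exact (contDiffOn_fst.div contDiffOn_snd hne).prodMk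
      ((contDiffOn_fst.pow 3).div (contDiffOn_snd.pow 2) fun z hz => pow_ne_zero _ (hne z hz))
  have h21 : ContDiffOn ℂ ω (moduliChart₂.symm.trans moduliChart₁)
      (moduliChart₂.symm.trans moduliChart₁).source := by
    refine ContDiffOn.congr (f := fun z : ℂ × ℂ => (z.2 / z.1 ^ 2, z.2 / z.1 ^ 3)) ?_
      fun z hz => (moduliChart₂_trans_source z hz).2
    have hne : ∀ z ∈ (moduliChart₂.symm.trans moduliChart₁).source, z.1 ≠ 0 :=
      fun z hz => (moduliChart₂_trans_source z hz).1
    exact (contDiffOn_snd.div (contDiffOn_fst.pow 2) fun z hz => pow_ne_zero _ (hne z hz)).prodMk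
      (contDiffOn_snd.div (contDiffOn_fst.pow 3) fun z hz => pow_ne_zero _ (hne z hz))
  have hself : ∀ e : OpenPartialHomeomorph Moduli (ℂ × ℂ),
      ContDiffOn ℂ ω (e.symm.trans e) (e.symm.trans e).source := fun e =>
    contDiffOn_id.congr fun z hz => e.right_inv hz.1
  have : HasGroupoid regularLocus (contDiffGroupoid ω 𝓘(ℂ, ℂ × ℂ)) := by
    constructor
    rintro e e' (rfl | rfl) (rfl | rfl)
    · exact moduliChart_compatible (hself _) (hself _)
    · exact moduliChart_compatible h12 h21
    · exact moduliChart_compatible h21 h12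
    · exact moduliChart_compatible (hself _) (hself _)
  exact IsManifold.mk' _ _ _

/-- The curve `X ⊆ ℳ`: classes of pairs such that the roots `λ₁, λ₂, λ₃` of `det(xC + D)` satisfy
the equation below, which is symmetric and homogeneous in the roots. -/
def criticalCurve : Set Moduli :=
  {m | ∃ p : conicPairs, proj p = m ∧ ∃ l₁ l₂ l₃ : ℂ,
    (pencil (fstMatrix p) (sndMatrix p)).roots = {l₁, l₂, l₃} ∧
    (l₁ - 2 * l₂ + l₃) * (l₁ + l₂ - 2 * l₃) * (2 * l₁ - l₂ - l₃) *
      (l₁ ^ 2 - l₁ * l₂ - l₁ * l₃ + l₂ ^ 2 - l₂ * l₃ + l₃ ^ 2) ^ 2 = 0}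

end ConicPairs

end

noncomputable section

namespace ConicPairs

/-! ## The `j`-invariant as a function of the coefficients -/

/-! Write `det(xC + D)` as a multiple of `x³ + ax² + bx + c` and put P = a² - 3b, Q = 2a³ - 9ab +
27c. Up to constants these are the coefficients of the depressed cubic X³ - (P/3)X + Q/27, and the
discriminant D satisfies 27D = 4P³ - Q². Hence j = 256P³/D and j - 1728 = 64Q²/D. So j vanishes
exactly where P does, and equals 1728 exactly where Q vanishes. Both P³/D and Q²/D have weight 0 for
the action (ta, t²b, t³c), and therefore j descends to the weighted projective description of the
moduli space; surjectivity of the projection gives uniqueness.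

Everything about critical points comes from one formula (`hasDerivAt_jForm`): dj = (256/27) P²Q (2P
dQ - 3Q dP) / D². If PQ = 0, the derivative vanishes whatever family of cubics is considered. If PQ
≠ 0, it suffices to find one direction in which 2P dQ - 3Q dP is non-zero; moving c alone works,
since then dP = 0 and dQ = 27 dc. Consequently, on the regular locus as well as on the space of
pairs, a point is critical if and only if its value is 0 or 1728 (`surjective_mfderiv_iff_of_jForm`,
applied in `jBar_chart` and `jInv_chart`). Explicit cubics show that both values occur.

The curve X enters because, in terms of the roots, its equation is -P²Q, the factor in dj. The
singular point has a = b = 0, hence P = 0, and so lies on X.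

On the space of pairs the required direction is obtained without proving that the projection is a
submersion: each pair is congruent to a model pair in which c occurs only in the second conic, and
varying c there yields a curve through the given pair.

Finally, an automorphism of the curve is determined by its scaling u, subject to u⁴P = P and u⁶Q =
Q. Since D ≠ 0, P and Q do not both vanish, so the group is the group of roots of unity of order 6,
4 or 2. -/

/-- `c₄ / 16` for the curve `y² = x³ + ax² + bx + c`. -/
def quadForm (a b : ℂ) : ℂ := a ^ 2 - 3 * b

/-- `-c₆ / 32` for the curve `y² = x³ + ax² + bx + c`. -/
def cubicForm (a b c : ℂ) : ℂ := 2 * a ^ 3 - 9 * a * b + 27 * c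

/-- The `j`-invariant of `y² = x³ + ax² + bx + c`. -/
def jForm (w : ℂ × ℂ × ℂ) : ℂ := 256 * quadForm w.1 w.2.1 ^ 3 / cubicDisc w.1 w.2.1 w.2.2

theorem cubicDisc_eq (a b c : ℂ) :
    27 * cubicDisc a b c = 4 * quadForm a b ^ 3 - cubicForm a b c ^ 2 := by
  simp only [cubicDisc, quadForm, cubicForm]
  ring

theorem jInv_eq (p : conicPairs) : jInv p = jForm (coeffs p) := by
  have hΔ : (ellipticCurve p).Δ =
      16 * cubicDisc (coeffs p).1 (coeffs p).2.1 (coeffs p).2.2 := pencilCurve_Δ _ _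
  have hc : (ellipticCurve p).c₄ = 16 * quadForm (coeffs p).1 (coeffs p).2.1 := by
    simp only [WeierstrassCurve.c₄, WeierstrassCurve.b₂, WeierstrassCurve.b₄, quadForm, coeffs,
      ellipticCurve, pencilCurve]
    ring
  have hd := coeffs_disc_ne_zero p
  rw [jInv, WeierstrassCurve.j, Units.val_inv_eq_inv_val, WeierstrassCurve.coe_Δ', hΔ, hc, jForm]
  field_simp
  ring

/-- P has weight 2 and the discriminant weight 6, so the powers of t cancel in P³/D. -/
theorem jForm_congr {w w' : ℂ × ℂ × ℂ} (h : WeightedEq w w') : jForm w = jForm w' := by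
  obtain ⟨t, ht, rfl⟩ := h
  have e1 : quadForm (t * w.1) (t ^ 2 * w.2.1) = t ^ 2 * quadForm w.1 w.2.1 := by
    simp only [quadForm]
    ring
  have e2 : cubicDisc (t * w.1) (t ^ 2 * w.2.1) (t ^ 3 * w.2.2) =
      t ^ 6 * cubicDisc w.1 w.2.1 w.2.2 := by
    simp only [cubicDisc]
    ring
  simp only [jForm, e1, e2]
  rw [show 256 * (t ^ 2 * quadForm w.1 w.2.1) ^ 3 = t ^ 6 * (256 * quadForm w.1 w.2.1 ^ 3) by ring,
    mul_div_mul_left _ _ (pow_ne_zero _ ht)]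

theorem jForm_eq_zero_iff {w : ℂ × ℂ × ℂ} (hw : cubicDisc w.1 w.2.1 w.2.2 ≠ 0) :
    jForm w = 0 ↔ quadForm w.1 w.2.1 = 0 := by
  simp [jForm, hw]

/-- By `cubicDisc_eq`, j - 1728 = 64 Q²/D. -/
theorem jForm_eq_iff {w : ℂ × ℂ × ℂ} (hw : cubicDisc w.1 w.2.1 w.2.2 ≠ 0) :
    jForm w = 1728 ↔ cubicForm w.1 w.2.1 w.2.2 = 0 := by
  rw [jForm, div_eq_iff hw, ← pow_eq_zero_iff (two_ne_zero)]
  have := cubicDisc_eq w.1 w.2.1 w.2.2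
  constructor <;> intro h
  · linear_combination this + h / 64
  · linear_combination 64 * h - 64 * this

theorem contDiffAt_jForm {w : ℂ × ℂ × ℂ} (hw : cubicDisc w.1 w.2.1 w.2.2 ≠ 0) :
    ContDiffAt ℂ ω jForm w := by
  unfold jForm
  refine ContDiffAt.div ?_ ?_ hw
  · simp only [quadForm]
    fun_prop
  · simp only [cubicDisc]
    fun_prop

/-- The quotient rule for P³/D, with 27D = 4P³ - Q² substituted: the two terms in P⁵ dP cancel, and
P²Q factors out of the rest. The statement is made along arbitrary curves so that it serves both the
vanishing of the full derivative and the choice of a non-critical direction. -/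
theorem hasDerivAt_jForm {a b c : ℂ → ℂ} {a' b' c' t : ℂ} (ha : HasDerivAt a a' t)
    (hb : HasDerivAt b b' t) (hc : HasDerivAt c c' t) (hw : cubicDisc (a t) (b t) (c t) ≠ 0) :
    HasDerivAt (fun s => jForm (a s, b s, c s))
      (256 / 27 * quadForm (a t) (b t) ^ 2 * cubicForm (a t) (b t) (c t) *
        (2 * quadForm (a t) (b t) *
            ((6 * a t ^ 2 - 9 * b t) * a' - 9 * a t * b' + 27 * c') -
          3 * cubicForm (a t) (b t) (c t) * (2 * a t * a' - 3 * b')) /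
        cubicDisc (a t) (b t) (c t) ^ 2) t := by
  have hP : HasDerivAt (fun s => quadForm (a s) (b s)) (2 * a t * a' - 3 * b') t := by
    refine ((ha.pow 2).sub (hb.const_mul 3)).congr_deriv ?_
    norm_num
  have hQ : HasDerivAt (fun s => cubicForm (a s) (b s) (c s))
      ((6 * a t ^ 2 - 9 * b t) * a' - 9 * a t * b' + 27 * c') t := by
    refine ((((ha.pow 3).const_mul 2).sub ((ha.const_mul 9).mul hb)).add
      (hc.const_mul 27)).congr_deriv ?_
    norm_num
    ring
  have hD : HasDerivAt (fun s => cubicDisc (a s) (b s) (c s)) (1 / 27 *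
      (12 * quadForm (a t) (b t) ^ 2 * (2 * a t * a' - 3 * b') -
        2 * cubicForm (a t) (b t) (c t) *
          ((6 * a t ^ 2 - 9 * b t) * a' - 9 * a t * b' + 27 * c'))) t := by
    have e : (fun s => cubicDisc (a s) (b s) (c s)) = fun s =>
        1 / 27 * (4 * quadForm (a s) (b s) ^ 3 - cubicForm (a s) (b s) (c s) ^ 2) := by
      funext s
      rw [← cubicDisc_eq]
      ring
    rw [e]
    refine ((((hP.pow 3).const_mul 4).sub (hQ.pow 2)).const_mul (1 / 27)).congr_deriv ?_
    norm_num
    ring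
  refine (((hP.pow 3).const_mul 256).div hD hw).congr_deriv ?_
  have := cubicDisc_eq (a t) (b t) (c t)
  simp only [Pi.pow_apply, Nat.cast_ofNat]
  congr 1
  -- This replaces the D left undifferentiated in the term 3·256·P² dP·D by (4P³ - Q²)/27; hence the
  -- constant 768/27 = 256/9.
  linear_combination (256 / 9) * quadForm (a t) (b t) ^ 2 * (2 * a t * a' - 3 * b') * this

/-- The derivative along every line through w carries the factor P²Q. -/
theorem fderiv_jForm_eq_zero {w : ℂ × ℂ × ℂ} (hw : cubicDisc w.1 w.2.1 w.2.2 ≠ 0)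
    (h : quadForm w.1 w.2.1 * cubicForm w.1 w.2.1 w.2.2 = 0) : fderiv ℂ jForm w = 0 := by
  refine ContinuousLinearMap.ext fun v => ?_
  have hl : ∀ x y : ℂ, HasDerivAt (fun s : ℂ => x + s * y) y 0 := fun x y => by
    simpa using ((hasDerivAt_id (0 : ℂ)).mul_const y).const_add x
  have h1 := hasDerivAt_jForm (hl w.1 v.1) (hl w.2.1 v.2.1) (hl w.2.2 v.2.2) (by simpa using hw)
  have h2 : HasDerivAt (fun s : ℂ => jForm (w + s • v)) (fderiv ℂ jForm w v) 0 := by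
    have hc : HasDerivAt (fun s : ℂ => w + s • v) v 0 := by
      simpa using ((hasDerivAt_id (0 : ℂ)).smul_const v).const_add w
    have hJ : HasFDerivAt jForm (fderiv ℂ jForm w) (w + (0 : ℂ) • v) := by
      simpa using ((contDiffAt_jForm hw).differentiableAt (by simp)).hasFDerivAt
    exact hJ.comp_hasDerivAt (0 : ℂ) hc
  rw [h2.unique h1]
  have h' : quadForm w.1 w.2.1 ^ 2 * cubicForm w.1 w.2.1 w.2.2 = 0 := by
    rw [sq, mul_assoc, h, mul_zero]
  simp only [zero_mul, add_zero, mul_assoc (256 / 27 : ℂ), h', mul_zero, zero_div]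
  rfl

/-! ## Scalar functions in charts -/

section Charts

variable {E H M : Type*} [NormedAddCommGroup E] [NormedSpace ℂ E] [TopologicalSpace H]
  {I : ModelWithCorners ℂ E H} [TopologicalSpace M] [ChartedSpace H M]
  {f : M → ℂ} {G : E → ℂ} {x : M}

theorem contMDiffAt_of_eventuallyEq_extChartAt [IsManifold I ω M]
    (h : f =ᶠ[𝓝 x] G ∘ extChartAt I x) (hG : ContDiffAt ℂ ω G (extChartAt I x x)) :
    ContMDiffAt I 𝓘(ℂ, ℂ) ω f x :=
  (hG.contMDiffAt.comp x contMDiffAt_extChartAt).congr_of_eventuallyEq h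

/-- The chart has an invertible derivative, so surjectivity can be tested on G; and a linear form
with values in ℂ is onto as soon as it is non-zero. -/
theorem surjective_mfderiv_iff_of_eventuallyEq_extChartAt [IsManifold I 1 M]
    (h : f =ᶠ[𝓝 x] G ∘ extChartAt I x) (hG : DifferentiableAt ℂ G (extChartAt I x x)) :
    Function.Surjective (mfderiv I 𝓘(ℂ, ℂ) f x) ↔ fderiv ℂ G (extChartAt I x x) ≠ 0 := by
  have hx : MDifferentiableAt I 𝓘(ℂ, E) (extChartAt I x) x :=
    mdifferentiableAt_extChartAt (mem_chart_source H x)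
  have e : mfderiv I 𝓘(ℂ, ℂ) f x =
      (fderiv ℂ G (extChartAt I x x)).comp (mfderiv I 𝓘(ℂ, E) (extChartAt I x) x) := by
    rw [h.mfderiv_eq, mfderiv_comp x hG.mdifferentiableAt hx, mfderiv_eq_fderiv]
    rfl
  obtain ⟨A, hA⟩ := isInvertible_mfderiv_extChartAt (I := I) (mem_extChartAt_source (I := I) x)
  have hs : Function.Surjective (mfderiv I 𝓘(ℂ, ℂ) f x) ↔
      Function.Surjective (fderiv ℂ G (extChartAt I x x)) := by
    rw [e, ← hA]
    exact A.surjective.of_comp_iff (fderiv ℂ G (extChartAt I x x))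
  rw [hs]
  constructor
  · intro h1 h0
    obtain ⟨v, hv⟩ := h1 1
    rw [h0] at hv
    exact zero_ne_one hv
  · intro h0
    exact LinearMap.surjective (f := (fderiv ℂ G (extChartAt I x x) : E →ₗ[ℂ] ℂ)) fun h1 => h0 (by
      ext v
      exact LinearMap.congr_fun h1 v)

end Charts

/-! ## Automorphism groups -/

/-- Keeping a₁ = a₃ = 0 forces s = t = 0. The value of r is forced because the centroid -a/3 of the
roots must be fixed. After translation to the depressed cubic, the remaining conditions say that its
two coefficients, multiples of P and Q, are preserved under scaling with weights 4 and 6. -/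
theorem mem_stabilizer_pencilCurve_iff (p : conicPairs)
    (g : WeierstrassCurve.VariableChange ℂ) :
    g ∈ MulAction.stabilizer (WeierstrassCurve.VariableChange ℂ) (ellipticCurve p) ↔
      g.s = 0 ∧ g.t = 0 ∧ g.r = ((g.u : ℂ) ^ 2 - 1) * (coeffs p).1 / 3 ∧
        (g.u : ℂ) ^ 4 * quadForm (coeffs p).1 (coeffs p).2.1 =
          quadForm (coeffs p).1 (coeffs p).2.1 ∧
        (g.u : ℂ) ^ 6 * cubicForm (coeffs p).1 (coeffs p).2.1 (coeffs p).2.2 =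
          cubicForm (coeffs p).1 (coeffs p).2.1 (coeffs p).2.2 := by
  obtain ⟨u, r, s, t⟩ := g
  have hu := u.ne_zero
  have h1 : (ellipticCurve p).a₁ = 0 := rfl
  have h3 : (ellipticCurve p).a₃ = 0 := rfl
  rw [MulAction.mem_stabilizer_iff, WeierstrassCurve.variableChange_def,
    WeierstrassCurve.ext_iff]
  simp only [h1, h3, coeffs]
  generalize (ellipticCurve p).a₂ = a
  generalize (ellipticCurve p).a₄ = b
  generalize (ellipticCurve p).a₆ = c
  simp only [quadForm, cubicForm, Units.val_inv_eq_inv_val]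
  generalize (u : ℂ) = x at *
  constructor
  · rintro ⟨e1, e2, e3, e4, e6⟩
    have hs : s = 0 := by simpa [hu] using e1
    have ht : t = 0 := by simpa [hu] using e3
    subst hs ht
    field_simp at e2 e4 e6
    have hr : r = (x ^ 2 - 1) * a / 3 := by linear_combination e2 / 3
    refine ⟨rfl, rfl, hr, ?_, ?_⟩
    · subst hr
      linear_combination 3 * e4
    · subst hr
      -- The multiple of `e6` supplies 27c, and that of `e4` supplies -9ab; the factor x² raises the
      -- weight of `e4` to 6.
      linear_combination (-27) * e6 + 9 * a * x ^ 2 * e4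
  · rintro ⟨rfl, rfl, hr, e4, e6⟩
    have e4' : b + 2 * r * a + 3 * r ^ 2 = x ^ 4 * b := by
      subst hr
      linear_combination e4 / 3
    refine ⟨by simp, ?_, by simp, ?_, ?_⟩
    · field_simp
      linear_combination 3 * hr
    · field_simp
      linear_combination e4'
    · field_simp
      subst hr
      linear_combination (-1 / 27) * e6 + a * x ^ 2 / 3 * e4'

/-- Since r, s, t are functions of u, an automorphism is the same as an admissible u; counting them
is counting n-th roots of unity. -/
theorem card_stabilizer_ellipticCurve (p : conicPairs) (n : ℕ) [NeZero n]
    (h : ∀ u : ℂˣ, ((u : ℂ) ^ 4 * quadForm (coeffs p).1 (coeffs p).2.1 =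
          quadForm (coeffs p).1 (coeffs p).2.1 ∧
        (u : ℂ) ^ 6 * cubicForm (coeffs p).1 (coeffs p).2.1 (coeffs p).2.2 =
          cubicForm (coeffs p).1 (coeffs p).2.1 (coeffs p).2.2) ↔ (u : ℂ) ^ n = 1) :
    Nat.card (MulAction.stabilizer (WeierstrassCurve.VariableChange ℂ) (ellipticCurve p)) = n := by
  rw [← Complex.card_rootsOfUnity n]
  refine Nat.card_congr
    { toFun := fun g => ⟨g.1.u, ?_⟩
      invFun := fun u => ⟨⟨u.1, ((u.1 : ℂ) ^ 2 - 1) * (coeffs p).1 / 3, 0, 0⟩, ?_⟩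
      left_inv := ?_
      right_inv := fun u => rfl }
  · rw [mem_rootsOfUnity', ← h]
    exact ((mem_stabilizer_pencilCurve_iff p _).1 g.2).2.2.2
  · refine (mem_stabilizer_pencilCurve_iff p _).2 ⟨rfl, rfl, rfl, ?_⟩
    exact (h u.1).2 ((mem_rootsOfUnity' _ _).1 u.2)
  · rintro ⟨g, hg⟩
    obtain ⟨h1, h2, h3, -⟩ := (mem_stabilizer_pencilCurve_iff p _).1 hg
    ext <;> simp [h1, h2, h3]

/-- P and Q cannot both vanish, as 4P³ - Q² = 27D ≠ 0. When one vanishes, only the condition u⁶ = 1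
or u⁴ = 1 from the other survives. -/
theorem card_automorphisms (p : conicPairs) :
    (jInv p = 0 → Nat.card (MulAction.stabilizer
        (WeierstrassCurve.VariableChange ℂ) (ellipticCurve p)) = 6) ∧
      (jInv p = 1728 → Nat.card (MulAction.stabilizer
        (WeierstrassCurve.VariableChange ℂ) (ellipticCurve p)) = 4) ∧
      (jInv p ≠ 0 → jInv p ≠ 1728 → Nat.card (MulAction.stabilizer
        (WeierstrassCurve.VariableChange ℂ) (ellipticCurve p)) = 2) := by
  have hd := coeffs_disc_ne_zero p
  have hD := cubicDisc_eq (coeffs p).1 (coeffs p).2.1 (coeffs p).2.2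
  rw [jInv_eq, Ne, Ne, jForm_eq_zero_iff hd, jForm_eq_iff hd]
  refine ⟨fun hP => ?_, fun hQ => ?_, fun hP hQ => ?_⟩
  · have hQ : cubicForm (coeffs p).1 (coeffs p).2.1 (coeffs p).2.2 ≠ 0 := fun hQ => by
      simp [hP, hQ, hd] at hD
    exact card_stabilizer_ellipticCurve p 6 fun u => by simp [hP, hQ]
  · have hP : quadForm (coeffs p).1 (coeffs p).2.1 ≠ 0 := fun hP => by
      simp [hP, hQ, hd] at hD
    exact card_stabilizer_ellipticCurve p 4 fun u => by simp [hP, hQ]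
  · refine card_stabilizer_ellipticCurve p 2 fun u => ?_
    rw [mul_eq_right₀ hP, mul_eq_right₀ hQ]
    constructor
    · rintro ⟨h4, h6⟩
      -- When neither form vanishes, u⁴ = u⁶ = 1 leaves u² = 1, because gcd(4, 6) = 2.
      linear_combination h6 - (u : ℂ) ^ 2 * h4
    · intro h2
      constructor
      · linear_combination ((u : ℂ) ^ 2 + 1) * h2
      · linear_combination ((u : ℂ) ^ 4 + (u : ℂ) ^ 2 + 1) * h2

/-! ## The critical curve -/

/-- In terms of the roots, P is the quadratic factor of the equation of X and Q is minus the product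
of its three linear factors. Only this inclusion of {PQ = 0} in X is needed, since the submersion
claims concern the complement of X. -/
theorem mem_criticalCurve {p : conicPairs}
    (h : quadForm (coeffs p).1 (coeffs p).2.1 *
      cubicForm (coeffs p).1 (coeffs p).2.1 (coeffs p).2.2 = 0) : proj p ∈ criticalCurve := by
  have hC : (pencil (fstMatrix p) (sndMatrix p)).coeff 3 ≠ 0 := by
    rw [pencil_coeff_three]
    exact p.2.1
  refine ⟨p, rfl, ?_⟩
  simp only [coeffs, ellipticCurve, pencilCurve] at h
  rw [pencil_eq] at h hC ⊢
  -- The determinantal coefficients play no further role: Vieta's formulas for an arbitrary cubic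
  -- suffice.
  generalize (⟨_, _, _, _⟩ : Cubic ℂ) = P at h hC ⊢
  simp only [Cubic.coeff_eq_a, Cubic.coeff_eq_b, Cubic.coeff_eq_c, Cubic.coeff_eq_d] at h hC
  obtain ⟨l₁, l₂, l₃, hr⟩ := (Cubic.splits_iff_roots_eq_three (φ := RingHom.id ℂ) hC).1
    (IsAlgClosed.splits _)
  have hb := Cubic.b_eq_three_roots hC hr
  have hc := Cubic.c_eq_three_roots hC hr
  have hd := Cubic.d_eq_three_roots hC hr
  simp only [RingHom.id_apply] at hb hc hd
  refine ⟨l₁, l₂, l₃, ?_, ?_⟩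
  · simpa [Cubic.map_roots] using hr
  · rw [hb, hc, hd, mul_div_cancel_left₀ _ hC, mul_div_cancel_left₀ _ hC,
      mul_div_cancel_left₀ _ hC] at h
    simp only [quadForm, cubicForm] at h
    -- The left side of the equation of X is -P²Q = -P·(PQ).
    linear_combination -(l₁ ^ 2 - l₁ * l₂ - l₁ * l₃ + l₂ ^ 2 - l₂ * l₃ + l₃ ^ 2) * h

/-! ## Critical points of functions that are the `j`-invariant of a family of cubics -/

theorem jForm_eq_or_iff {w : ℂ × ℂ × ℂ} (hw : cubicDisc w.1 w.2.1 w.2.2 ≠ 0) :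
    jForm w = 0 ∨ jForm w = 1728 ↔
      quadForm w.1 w.2.1 * cubicForm w.1 w.2.1 w.2.2 = 0 := by
  rw [jForm_eq_zero_iff hw, jForm_eq_iff hw, mul_eq_zero]

theorem cubicDisc_ne_zero_congr {w w' : ℂ × ℂ × ℂ} (h : WeightedEq w w')
    (hw : cubicDisc w.1 w.2.1 w.2.2 ≠ 0) : cubicDisc w'.1 w'.2.1 w'.2.2 ≠ 0 := by
  obtain ⟨t, ht, rfl⟩ := h
  have e2 : cubicDisc (t * w.1) (t ^ 2 * w.2.1) (t ^ 3 * w.2.2) =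
      t ^ 6 * cubicDisc w.1 w.2.1 w.2.2 := by
    simp only [cubicDisc]
    ring
  rw [e2]
  exact mul_ne_zero (pow_ne_zero _ ht) hw

section Family

variable {E H M : Type*} [NormedAddCommGroup E] [NormedSpace ℂ E] [TopologicalSpace H]
  {I : ModelWithCorners ℂ E H} [TopologicalSpace M] [ChartedSpace H M]
  {f : M → ℂ} {φ : E → ℂ × ℂ × ℂ} {x : M}

theorem contMDiffAt_of_jForm [IsManifold I ω M]
    (h : f =ᶠ[𝓝 x] (jForm ∘ φ) ∘ extChartAt I x) (hφ : ContDiffAt ℂ ω φ (extChartAt I x x))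
    (hw : cubicDisc (φ (extChartAt I x x)).1 (φ (extChartAt I x x)).2.1
      (φ (extChartAt I x x)).2.2 ≠ 0) : ContMDiffAt I 𝓘(ℂ, ℂ) ω f x :=
  contMDiffAt_of_eventuallyEq_extChartAt h ((contDiffAt_jForm hw).comp _ hφ)

/-- Where PQ = 0 the derivative of `jForm` is already zero, so nothing is asked of φ there.
Elsewhere a single curve along which j moves with non-zero speed rules out a zero derivative. Thus φ
need not be shown to be a submersion. -/
theorem surjective_mfderiv_iff_of_jForm [IsManifold I 1 M]
    (h : f =ᶠ[𝓝 x] (jForm ∘ φ) ∘ extChartAt I x) (hφ : ContDiffAt ℂ ω φ (extChartAt I x x))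
    (hw : cubicDisc (φ (extChartAt I x x)).1 (φ (extChartAt I x x)).2.1
      (φ (extChartAt I x x)).2.2 ≠ 0)
    (hγ : quadForm (φ (extChartAt I x x)).1 (φ (extChartAt I x x)).2.1 *
        cubicForm (φ (extChartAt I x x)).1 (φ (extChartAt I x x)).2.1
          (φ (extChartAt I x x)).2.2 ≠ 0 →
      ∃ (γ : ℂ → E) (γ' : E) (t d : ℂ), γ t = extChartAt I x x ∧ HasDerivAt γ γ' t ∧
        HasDerivAt (fun s => jForm (φ (γ s))) d t ∧ d ≠ 0) :
    Function.Surjective (mfderiv I 𝓘(ℂ, ℂ) f x) ↔ ¬ (f x = 0 ∨ f x = 1728) := by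
  have hφ' := hφ.differentiableAt (by simp)
  have hJ := (contDiffAt_jForm hw).differentiableAt (by simp)
  rw [surjective_mfderiv_iff_of_eventuallyEq_extChartAt h (hJ.comp _ hφ'), h.eq_of_nhds,
    Function.comp_apply, Function.comp_apply, jForm_eq_or_iff hw]
  refine not_congr ⟨fun h0 => ?_, fun h0 => ?_⟩
  · by_contra hne
    obtain ⟨γ, γ', t, d, ht, h1, h2, hd⟩ := hγ hne
    have h3 : HasFDerivAt (jForm ∘ φ) (0 : E →L[ℂ] ℂ) (γ t) := by
      rw [ht, ← h0]
      exact (hJ.comp _ hφ').hasFDerivAt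
    exact hd (h2.unique (h3.comp_hasDerivAt t h1))
  · rw [fderiv_comp _ hJ hφ', fderiv_jForm_eq_zero hw h0, ContinuousLinearMap.zero_comp]

end Family

/-! ## The function on the moduli space -/

/-- The function `j̄ : ℳ → ℂ` induced by the `j`-invariant. -/
def jBar (m : Moduli) : ℂ := jForm (coeffs (Quotient.out m))

theorem jInv_eq_jBar (p : conicPairs) : jInv p = jBar (proj p) := by
  rw [jInv_eq]
  exact jForm_congr (weightedEq_out p).symm

theorem extChartAt_regularLocus₁ {m : regularLocus} (h : (coeffs (Quotient.out m.1)).1 ≠ 0)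
    (q : regularLocus) : extChartAt 𝓘(ℂ, ℂ × ℂ) m q = moduliChart₁ q.1 := by
  have e : chartAt (ℂ × ℂ) m = moduliChart₁.subtypeRestr (s := regularLocus) inferInstance :=
    if_pos h
  rw [extChartAt_coe, e]
  rfl

theorem extChartAt_regularLocus₂ {m : regularLocus} (h : ¬ (coeffs (Quotient.out m.1)).1 ≠ 0)
    (q : regularLocus) : extChartAt 𝓘(ℂ, ℂ × ℂ) m q = moduliChart₂ q.1 := by
  have e : chartAt (ℂ × ℂ) m = moduliChart₂.subtypeRestr (s := regularLocus) inferInstance :=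
    if_neg h
  rw [extChartAt_coe, e]
  rfl

/-- The scaling t = a undoes the normalization to x³ + x² + ux + v. -/
theorem weightedEq_moduliChart₁ {m : Moduli} (h : (coeffs (Quotient.out m)).1 ≠ 0) :
    WeightedEq (1, (moduliChart₁ m).1, (moduliChart₁ m).2) (coeffs (Quotient.out m)) := by
  refine ⟨_, h, ?_⟩
  ext <;> simp [moduliChart₁] <;> field_simp

/-- The scaling t = c/b undoes the normalization to x³ + ux² + vx + v. -/
theorem weightedEq_moduliChart₂ {m : Moduli} (h : (coeffs (Quotient.out m)).2.1 ≠ 0) :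
    WeightedEq ((moduliChart₂ m).1, (moduliChart₂ m).2, (moduliChart₂ m).2)
      (coeffs (Quotient.out m)) := by
  have h6 := coeffs_a₆_ne_zero (Quotient.out m)
  refine ⟨_, div_ne_zero h6 h, ?_⟩
  ext <;> simp [moduliChart₂] <;> field_simp

/-- In the first chart c is itself a coordinate. In the second b and c are tied together, so c
cannot move alone and two directions have to be considered. -/
theorem jBar_chart (m : regularLocus) :
    ContMDiffAt 𝓘(ℂ, ℂ × ℂ) 𝓘(ℂ, ℂ) ω (fun m : regularLocus => jBar m) m ∧
      (Function.Surjective (mfderiv 𝓘(ℂ, ℂ × ℂ) 𝓘(ℂ, ℂ) (fun m : regularLocus => jBar m) m) ↔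
        ¬ (jBar m = 0 ∨ jBar m = 1728)) := by
  have : IsManifold 𝓘(ℂ, ℂ × ℂ) 1 regularLocus := IsManifold.of_le (n := ω) (by simp)
  have hd := coeffs_disc_ne_zero (Quotient.out m.1)
  by_cases h : (coeffs (Quotient.out m.1)).1 ≠ 0
  · have hev : (fun m : regularLocus => jBar m) =ᶠ[𝓝 m]
        (jForm ∘ fun z : ℂ × ℂ => (1, z.1, z.2)) ∘ extChartAt 𝓘(ℂ, ℂ × ℂ) m := by
      filter_upwards [(isOpen_coeffs_ne_zero.1.preimage continuous_subtype_val).mem_nhds h]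
        with q hq
      simp only [Function.comp_apply, extChartAt_regularLocus₁ h]
      exact (jForm_congr (weightedEq_moduliChart₁ hq)).symm
    have hw := cubicDisc_ne_zero_congr (weightedEq_moduliChart₁ h).symm hd
    rw [← extChartAt_regularLocus₁ h m] at hw
    have hφ : ContDiffAt ℂ ω (fun z : ℂ × ℂ => ((1, z.1, z.2) : ℂ × ℂ × ℂ))
      (extChartAt 𝓘(ℂ, ℂ × ℂ) m m) := by fun_prop
    refine ⟨contMDiffAt_of_jForm hev hφ hw, surjective_mfderiv_iff_of_jForm hev hφ hw ?_⟩
    generalize extChartAt 𝓘(ℂ, ℂ × ℂ) m m = z at hw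
    intro hne
    have hP := left_ne_zero_of_mul hne
    have hQ := right_ne_zero_of_mul hne
    -- Moving c alone gives dP = 0 and dQ = 27, so 2P dQ - 3Q dP becomes 54P.
    refine ⟨fun s => (z.1, s), (0, 1), z.2, _, rfl,
      (hasDerivAt_const _ _).prodMk (hasDerivAt_id _),
      hasDerivAt_jForm (hasDerivAt_const _ _) (hasDerivAt_const _ _) (hasDerivAt_id _) hw, ?_⟩
    refine div_ne_zero (mul_ne_zero (mul_ne_zero (mul_ne_zero (by norm_num)
      (pow_ne_zero _ hP)) hQ) ?_) (pow_ne_zero _ hw)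
    simpa using hP
  · have h2 := m.2.resolve_left h
    have hev : (fun m : regularLocus => jBar m) =ᶠ[𝓝 m]
        (jForm ∘ fun z : ℂ × ℂ => (z.1, z.2, z.2)) ∘ extChartAt 𝓘(ℂ, ℂ × ℂ) m := by
      filter_upwards [(isOpen_coeffs_ne_zero.2.preimage continuous_subtype_val).mem_nhds h2]
        with q hq
      simp only [Function.comp_apply, extChartAt_regularLocus₂ h]
      exact (jForm_congr (weightedEq_moduliChart₂ hq)).symm
    have hw := cubicDisc_ne_zero_congr (weightedEq_moduliChart₂ h2).symm hd
    have hv : (moduliChart₂ m.1).2 ≠ 0 := (moduliChart₂.map_source h2).1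
    rw [← extChartAt_regularLocus₂ h m] at hw hv
    have hφ : ContDiffAt ℂ ω (fun z : ℂ × ℂ => ((z.1, z.2, z.2) : ℂ × ℂ × ℂ))
      (extChartAt 𝓘(ℂ, ℂ × ℂ) m m) := by fun_prop
    refine ⟨contMDiffAt_of_jForm hev hφ hw, surjective_mfderiv_iff_of_jForm hev hφ hw ?_⟩
    generalize extChartAt 𝓘(ℂ, ℂ × ℂ) m m = z at hw hv
    intro hne
    have hP := left_ne_zero_of_mul hne
    have hQ := right_ne_zero_of_mul hne
    obtain ⟨u, v⟩ := z
    dsimp only at hP hQ hw hv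
    have h1 := hasDerivAt_jForm (hasDerivAt_id u) (hasDerivAt_const u v) (hasDerivAt_const u v) hw
    have h2 := hasDerivAt_jForm (hasDerivAt_const v u) (hasDerivAt_id v) (hasDerivAt_id v) hw
    have key : ∀ k : ℂ, k ≠ 0 → 256 / 27 * quadForm u v ^ 2 * cubicForm u v v * k /
        cubicDisc u v v ^ 2 ≠ 0 := fun k hk =>
      div_ne_zero (mul_ne_zero (mul_ne_zero (mul_ne_zero (by norm_num)
        (pow_ne_zero _ hP)) hQ) hk) (pow_ne_zero _ hw)
    -- Moving u alone gives 2P dQ - 3Q dP = 54v(v - 3u). On the line v = 3u, moving v gives 27u(9 -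
    -- u) instead. There u ≠ 0 because v ≠ 0, while u = 9 would make the cubic (x + 3)³, for which P
    -- = 0.
    by_cases huv : v = 3 * u
    · refine ⟨fun s => (u, s), (0, 1), v, _, rfl,
        (hasDerivAt_const _ _).prodMk (hasDerivAt_id _), h2, key _ ?_⟩
      subst huv
      have hu : u ≠ 0 := right_ne_zero_of_mul hv
      have hu9 : 9 - u ≠ 0 := fun h9 => hP (by
        rw [quadForm, ← sub_eq_zero.1 h9]
        norm_num)
      convert mul_ne_zero (mul_ne_zero (by norm_num : (27 : ℂ) ≠ 0) hu) hu9 using 1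
      simp only [quadForm, cubicForm, id]
      ring
    · refine ⟨fun s => (s, v), (1, 0), u, _, rfl,
        (hasDerivAt_id _).prodMk (hasDerivAt_const _ _), h1, key _ ?_⟩
      convert mul_ne_zero (mul_ne_zero (by norm_num : (54 : ℂ) ≠ 0) hv) (sub_ne_zero.2 huv)
        using 1
      simp only [quadForm, cubicForm, id]
      ring

/-! ### Attaining the two critical values -/

/-- The condition a ≠ 0 keeps the model pair away from the singular point, which has a = b = 0. -/
theorem exists_regular_jBar_eq {a b c : ℂ} (h : c ≠ 0 ∧ cubicDisc a b c ≠ 0) (ha : a ≠ 0) :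
    ∃ m : regularLocus, jBar m = jForm (a, b, c) := by
  refine ⟨⟨proj (modelPair a b c h), (proj_mem_regularLocus_iff _).2 (Or.inl ?_)⟩, ?_⟩
  · obtain ⟨t, ht, e⟩ := coeffs_modelPair a b c h
    change (coeffs _).1 ≠ 0
    rw [e]
    exact mul_ne_zero ht ha
  · rw [← jInv_eq_jBar, jInv_eq]
    exact (jForm_congr (coeffs_modelPair a b c h)).symm

theorem exists_jBar_eq_zero : ∃ m : regularLocus, jBar m = 0 := by
  -- The cubic is (x + 1)³ + 1. The translation matters: x³ + 1 also has P = 0, but represents the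
  -- singular point.
  obtain ⟨m, hm⟩ := exists_regular_jBar_eq (a := 3) (b := 3) (c := 2)
    (by norm_num [cubicDisc]) (by norm_num)
  exact ⟨m, by rw [hm]; norm_num [jForm, quadForm]⟩

theorem exists_jBar_eq : ∃ m : regularLocus, jBar m = 1728 := by
  -- The cubic is (x + 1)³ - 3(x + 1), whose roots are in arithmetic progression, so that Q = 0.
  obtain ⟨m, hm⟩ := exists_regular_jBar_eq (a := 3) (b := 0) (c := -2)
    (by norm_num [cubicDisc]) (by norm_num)
  exact ⟨m, by rw [hm]; norm_num [jForm, quadForm, cubicDisc]⟩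

/-! ## The function on the space of pairs of conics -/

/-- The coefficients `(a, b, c)` as a function of homogeneous coordinates. -/
def coeffsOf (x y : Fin (5 + 1) → ℂ) : ℂ × ℂ × ℂ :=
  ((pencilCurve (conicMatrix x) (conicMatrix y)).a₂,
    (pencilCurve (conicMatrix x) (conicMatrix y)).a₄,
    (pencilCurve (conicMatrix x) (conicMatrix y)).a₆)

theorem weightedEq_coeffsOf_smul (x y : Fin (5 + 1) → ℂ) {α β : ℂ} (hα : α ≠ 0) (hβ : β ≠ 0) :
    WeightedEq (coeffsOf x y) (coeffsOf (α • x) (β • y)) := by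
  obtain ⟨h2, h4, h6⟩ := pencilCurve_smul (conicMatrix x) (conicMatrix y) (β := β) hα
  refine ⟨β / α, div_ne_zero hβ hα, ?_⟩
  simp only [coeffsOf, conicMatrix_smul, h2, h4, h6]

theorem contDiff_homog {n : ℕ} (i : Fin (n + 1)) :
    ContDiff ℂ ω fun y : Fin n → ℂ => homog i y := by
  refine contDiff_pi.2 fun l => ?_
  rcases Fin.eq_self_or_eq_succAbove i l with rfl | ⟨k, rfl⟩
  · simpa using contDiff_const
  · simpa using contDiff_apply ℂ ℂ k

theorem contDiffAt_coeffsOf {z : (Fin (5 + 1) → ℂ) × (Fin (5 + 1) → ℂ)}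
    (hz : (conicMatrix z.1).det ≠ 0) :
    ContDiffAt ℂ ω (fun z : (Fin (5 + 1) → ℂ) × (Fin (5 + 1) → ℂ) => coeffsOf z.1 z.2) z := by
  have h : ∀ k ≤ 3, ContDiff ℂ ω fun z : (Fin (5 + 1) → ℂ) × (Fin (5 + 1) → ℂ) =>
      (pencil (conicMatrix z.1) (conicMatrix z.2)).coeff k := by
    intro k hk
    interval_cases k <;>
      simp only [pencil_coeff_three, pencil_coeff_two, pencil_coeff_one, pencil_coeff_zero,
        conicMatrix, Matrix.det_fin_three, Matrix.of_apply, Matrix.cons_val] <;> fun_prop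
  have h' : ∀ k ≤ 3, ContDiffAt ℂ ω (fun z : (Fin (5 + 1) → ℂ) × (Fin (5 + 1) → ℂ) =>
      (pencil (conicMatrix z.1) (conicMatrix z.2)).coeff k /
        (pencil (conicMatrix z.1) (conicMatrix z.2)).coeff 3) z := fun k hk =>
    (h k hk).contDiffAt.div (h 3 le_rfl).contDiffAt (by rwa [pencil_coeff_three])
  exact (h' 2 (by norm_num)).prodMk ((h' 1 (by norm_num)).prodMk (h' 0 (by norm_num)))

/-- An index of a non-vanishing homogeneous coordinate. -/
def chartIndex (x : Conic) : Fin (5 + 1) := (exists_rep_ne_zero x).choose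

theorem rep_chartIndex_ne_zero (x : Conic) : x.rep (chartIndex x) ≠ 0 :=
  (exists_rep_ne_zero x).choose_spec

/-- Definitional, because `chartIndex` makes the same choice of index as the atlas of projective
space. -/
theorem extChartAt_conicPairs (p q : conicPairs) :
    extChartAt (𝓘(ℂ, Fin 5 → ℂ).prod 𝓘(ℂ, Fin 5 → ℂ)) p q =
      (affineChart (chartIndex p.1.1) q.1.1, affineChart (chartIndex p.1.2) q.1.2) := rfl

theorem homog_affineChart {x : Conic} {i : Fin (5 + 1)} (hx : x.rep i ≠ 0) :
    homog i (affineChart i x) = (x.rep i)⁻¹ • x.rep := by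
  funext l
  rcases Fin.eq_self_or_eq_succAbove i l with rfl | ⟨k, rfl⟩
  · simp [hx]
  · simp [affineChart, div_eq_inv_mul]

/-- The upper triangular entries of a matrix. -/
def upperEntries (N : Matrix (Fin 3) (Fin 3) ℂ) : Fin (5 + 1) → ℂ :=
  ![N 0 0, N 0 1, N 0 2, N 1 1, N 1 2, N 2 2]

theorem upperEntries_conicMatrix (x : Fin (5 + 1) → ℂ) : upperEntries (conicMatrix x) = x := by
  funext i
  fin_cases i <;> simp [upperEntries, conicMatrix]

theorem upperEntries_smul (a : ℂ) (N : Matrix (Fin 3) (Fin 3) ℂ) :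
    upperEntries (a • N) = a • upperEntries N := by
  funext i
  fin_cases i <;> simp [upperEntries]

theorem conicMatrix_upperEntries {N : Matrix (Fin 3) (Fin 3) ℂ} (hN : Nᵀ = N) :
    conicMatrix (upperEntries N) = N := by
  have h : ∀ i j, N i j = N j i := fun i j => congrFun (congrFun hN j) i
  ext i j
  fin_cases i <;> fin_cases j <;> simp [upperEntries, conicMatrix, h 1 0, h 2 0, h 2 1]

/-! ### Curves of pairs along which only c varies -/

/-- The class of a pair is determined by its weighted coefficients, so p is congruent to the model
built from its own a, b, c. The scalars absorb the choices of homogeneous coordinates. -/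
theorem exists_congruent_model (p : conicPairs) :
    ∃ A : Matrix (Fin 3) (Fin 3) ℂ, A.det ≠ 0 ∧ ∃ α β : ℂ, α ≠ 0 ∧ β ≠ 0 ∧
      fstMatrix p = α • (Aᵀ * conicMatrix (modelFst (coeffs p).1 (coeffs p).2.1) * A) ∧
      sndMatrix p = β • (Aᵀ * conicMatrix (modelSnd (coeffs p).1 (coeffs p).2.2) * A) := by
  have h := And.intro (coeffs_a₆_ne_zero p) (coeffs_disc_ne_zero p)
  obtain ⟨A, hA, α, β, hα, hβ, e1, e2⟩ :=
    Quotient.exact (proj_eq_of_weightedEq (coeffs_modelPair _ _ _ h).symm)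
  obtain ⟨s, hs, f1⟩ := exists_rep_smul _ (modelFst_ne_zero (coeffs p).1 (coeffs p).2.1)
  obtain ⟨t, ht, f2⟩ := exists_rep_smul _ (modelSnd_ne_zero (coeffs p).1 (coeffs p).2.2)
  refine ⟨A, hA, α * s, β * t, mul_ne_zero hα hs, mul_ne_zero hβ ht, ?_, ?_⟩
  · rw [e1, fstMatrix, modelPair, f1, conicMatrix_smul]
    simp [smul_smul]
  · rw [e2, sndMatrix, modelPair, f2, conicMatrix_smul]
    simp [smul_smul]

/-- Congruence multiplies the whole pencil by `A.det ^ 2`, which drops out of the monic cubic; only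
α rescales its coefficients. Here A is a fixed matrix and c is free, which permits c to be varied
along a curve. -/
theorem weightedEq_coeffsOf_model (A : Matrix (Fin 3) (Fin 3) ℂ) (hA : A.det ≠ 0) {α : ℂ}
    (hα : α ≠ 0) (a b c : ℂ) {x y : Fin (5 + 1) → ℂ}
    (hx : conicMatrix x = α • (Aᵀ * conicMatrix (modelFst a b) * A))
    (hy : conicMatrix y = Aᵀ * conicMatrix (modelSnd a c) * A) :
    WeightedEq (a, b, c) (coeffsOf x y) := by
  obtain ⟨h2, h4, h6⟩ := pencilCurve_congr (conicMatrix (modelFst a b))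
    (conicMatrix (modelSnd a c)) A (β := 1) hα hA
    (by simp [conicMatrix_modelFst, Matrix.det_fin_three])
  refine ⟨1 / α, one_div_ne_zero hα, ?_⟩
  rw [one_smul, ← hx, ← hy] at h2 h4 h6
  simp only [coeffsOf, h2, h4, h6]
  rw [conicMatrix_modelFst, conicMatrix_modelSnd]
  simp [pencilCurve, pencil_coeff_three, pencil_coeff_two, pencil_coeff_one, pencil_coeff_zero,
    Matrix.det_fin_three]

/-- In affine coordinates around `p`, there is a curve along which `(a, b)` is constant and `c`
varies with non-zero speed. -/
theorem exists_curve_coeffsOf (p : conicPairs) (j : Fin (5 + 1)) (hj : p.1.2.rep j ≠ 0) :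
    ∃ (γ : ℂ → Fin 5 → ℂ) (γ' : Fin 5 → ℂ), γ (coeffs p).2.2 = affineChart j p.1.2 ∧
      HasDerivAt γ γ' (coeffs p).2.2 ∧
      ∀ᶠ s in 𝓝 (coeffs p).2.2, ∀ r : ℂ, r ≠ 0 → WeightedEq ((coeffs p).1, (coeffs p).2.1, s)
        (coeffsOf (r • p.1.1.rep) (homog j (γ s))) := by
  obtain ⟨A, hA, α, β, hα, hβ, e1, e2⟩ := exists_congruent_model p
  -- The first model conic does not involve c, so with A fixed the first conic of p stays still and
  -- only the second one moves.
  let w : ℂ → Fin (5 + 1) → ℂ := fun s =>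
    upperEntries (Aᵀ * conicMatrix (modelSnd (coeffs p).1 s) * A)
  have hw : ∀ s, conicMatrix (w s) = Aᵀ * conicMatrix (modelSnd (coeffs p).1 s) * A := fun s =>
    conicMatrix_upperEntries (by
      simp only [Matrix.transpose_mul, Matrix.transpose_transpose, conicMatrix_transpose,
        mul_assoc])
  have hrep : p.1.2.rep = β • w (coeffs p).2.2 := by
    rw [← upperEntries_smul, ← e2, sndMatrix, upperEntries_conicMatrix]
  have hwd : Differentiable ℂ w := by
    rw [differentiable_pi]
    intro i
    fin_cases i <;>
      simp [w, upperEntries, conicMatrix_modelSnd, Matrix.mul_apply, Fin.sum_univ_three] <;>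
      fun_prop
  have hwj : w (coeffs p).2.2 j ≠ 0 := fun h => hj (by rw [hrep]; simp [h])
  have hdi : ∀ i, DifferentiableAt ℂ (fun s => w s i) (coeffs p).2.2 := fun i =>
    (differentiable_pi.1 hwd i) _
  -- The affine coordinates are ratios of entries of w, so the scalar β relating w to the
  -- representative of the second conic cancels.
  refine ⟨fun s k => w s (j.succAbove k) / w s j, _, ?_,
    (differentiableAt_pi.2 fun k => (hdi _).div (hdi j) hwj).hasDerivAt, ?_⟩
  · funext k
    change _ = p.1.2.rep _ / p.1.2.rep _
    rw [hrep]
    exact (mul_div_mul_left _ _ hβ).symm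
  · filter_upwards [(hdi j).continuousAt.eventually_ne hwj] with s hs r hr
    have eh : homog j (fun k => w s (j.succAbove k) / w s j) = (w s j)⁻¹ • w s := by
      funext l
      rcases Fin.eq_self_or_eq_succAbove j l with rfl | ⟨k, rfl⟩
      · simp [hs]
      · simp [div_eq_inv_mul]
    rw [eh]
    exact (weightedEq_coeffsOf_model A hA hα _ _ s e1 (hw s)).trans
      (weightedEq_coeffsOf_smul _ _ hr (inv_ne_zero hs))

theorem jInv_chart (p : conicPairs) :
    ContMDiffAt (𝓘(ℂ, Fin 5 → ℂ).prod 𝓘(ℂ, Fin 5 → ℂ)) 𝓘(ℂ, ℂ) ω jInv p ∧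
      (Function.Surjective (mfderiv (𝓘(ℂ, Fin 5 → ℂ).prod 𝓘(ℂ, Fin 5 → ℂ)) 𝓘(ℂ, ℂ) jInv p) ↔
        ¬ (jInv p = 0 ∨ jInv p = 1728)) := by
  have : IsManifold (𝓘(ℂ, Fin 5 → ℂ).prod 𝓘(ℂ, Fin 5 → ℂ)) 1 conicPairs :=
    IsManifold.of_le (n := ω) (by simp)
  set i := chartIndex p.1.1 with hi
  set j := chartIndex p.1.2 with hj
  have hpi : p.1.1.rep i ≠ 0 := rep_chartIndex_ne_zero _
  have hpj : p.1.2.rep j ≠ 0 := rep_chartIndex_ne_zero _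
  let φ : (Fin 5 → ℂ) × (Fin 5 → ℂ) → ℂ × ℂ × ℂ := fun z =>
    coeffsOf (homog i z.1) (homog j z.2)
  have hφq : ∀ q : conicPairs, q.1.1.rep i ≠ 0 → q.1.2.rep j ≠ 0 → WeightedEq (coeffs q)
      (φ (extChartAt (𝓘(ℂ, Fin 5 → ℂ).prod 𝓘(ℂ, Fin 5 → ℂ)) p q)) := by
    intro q h1 h2
    simp only [φ, extChartAt_conicPairs, ← hi, ← hj, homog_affineChart h1, homog_affineChart h2]
    exact weightedEq_coeffsOf_smul _ _ (inv_ne_zero h1) (inv_ne_zero h2)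
  have hev : jInv =ᶠ[𝓝 p]
      (jForm ∘ φ) ∘ extChartAt (𝓘(ℂ, Fin 5 → ℂ).prod 𝓘(ℂ, Fin 5 → ℂ)) p := by
    have o1 : ∀ᶠ q : conicPairs in 𝓝 p, q.1.1.rep i ≠ 0 :=
      (((affineChart i).open_source.preimage continuous_fst).preimage
        continuous_subtype_val).mem_nhds hpi
    have o2 : ∀ᶠ q : conicPairs in 𝓝 p, q.1.2.rep j ≠ 0 :=
      (((affineChart j).open_source.preimage continuous_snd).preimage
        continuous_subtype_val).mem_nhds hpj
    filter_upwards [o1, o2] with q h1 h2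
    rw [jInv_eq]
    exact jForm_congr (hφq q h1 h2)
  have hw := cubicDisc_ne_zero_congr (hφq p hpi hpj) (coeffs_disc_ne_zero p)
  have hφ : ContDiffAt ℂ ω φ (extChartAt (𝓘(ℂ, Fin 5 → ℂ).prod 𝓘(ℂ, Fin 5 → ℂ)) p p) := by
    have hh : ContDiff ℂ ω fun z : (Fin 5 → ℂ) × (Fin 5 → ℂ) => (homog i z.1, homog j z.2) :=
      ((contDiff_homog i).comp contDiff_fst).prodMk ((contDiff_homog j).comp contDiff_snd)
    have hdet : (conicMatrix (homog i (affineChart i p.1.1))).det ≠ 0 := by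
      have hp : Admissible p.1.1.rep p.1.2.rep := p.2
      rw [homog_affineChart hpi, conicMatrix_smul, Matrix.det_smul]
      exact mul_ne_zero (pow_ne_zero _ (inv_ne_zero hpi)) hp.1
    rw [extChartAt_conicPairs]
    have hc := contDiffAt_coeffsOf
      (z := (homog i (affineChart i p.1.1), homog j (affineChart j p.1.2))) hdet
    exact hc.comp (affineChart i p.1.1, affineChart j p.1.2) hh.contDiffAt
  refine ⟨contMDiffAt_of_jForm hev hφ hw, surjective_mfderiv_iff_of_jForm hev hφ hw fun hne => ?_⟩
  have hd := coeffs_disc_ne_zero p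
  -- The coefficients read off in the chart differ from `coeffs p` by a weighted rescaling. The
  -- condition PQ ≠ 0 passes between them because it says that j is neither 0 nor 1728.
  have hne' : quadForm (coeffs p).1 (coeffs p).2.1 *
      cubicForm (coeffs p).1 (coeffs p).2.1 (coeffs p).2.2 ≠ 0 := by
    rwa [Ne, ← jForm_eq_or_iff hd, jForm_congr (hφq p hpi hpj), jForm_eq_or_iff hw]
  have hP := left_ne_zero_of_mul hne'
  have hQ := right_ne_zero_of_mul hne'
  obtain ⟨γ, γ', h0, h1, h2⟩ := exists_curve_coeffsOf p j hpj
  refine ⟨fun s => (affineChart i p.1.1, γ s), (0, γ'), (coeffs p).2.2, _, ?_,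
    (hasDerivAt_const _ _).prodMk h1, (hasDerivAt_jForm (hasDerivAt_const _ (coeffs p).1)
      (hasDerivAt_const _ (coeffs p).2.1) (hasDerivAt_id _) hd).congr_of_eventuallyEq ?_, ?_⟩
  · simp only [h0]
    rfl
  · filter_upwards [h2] with s hs
    simp only [φ, homog_affineChart hpi]
    exact (jForm_congr (hs _ (inv_ne_zero hpi))).symm
  · refine div_ne_zero (mul_ne_zero (mul_ne_zero (mul_ne_zero (by norm_num)
      (pow_ne_zero _ hP)) hQ) ?_) (pow_ne_zero _ hd)
    simpa using hP

/-! ### Points outside the critical curve -/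

theorem not_eq_of_notMem_criticalCurve {m : Moduli} (hm : m ∉ criticalCurve) :
    ¬ (jBar m = 0 ∨ jBar m = 1728) := by
  rw [jBar, jForm_eq_or_iff (coeffs_disc_ne_zero _)]
  intro h
  exact hm (by simpa [proj_out] using mem_criticalCurve h)

/-- Outside the regular locus a = b = 0, hence P = 0; this is the assertion that the singular point
lies on X. -/
theorem mem_regularLocus_of_notMem_criticalCurve {m : Moduli} (hm : m ∉ criticalCurve) :
    m ∈ regularLocus := by
  by_contra h
  obtain ⟨h1, h2⟩ := not_or.1 h
  refine hm ?_
  rw [← proj_out m]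
  refine mem_criticalCurve ?_
  simp [not_not.1 h1, not_not.1 h2, quadForm]

end ConicPairs

end

/-! ### Assembly of the theorem -/

theorem mainTheorem7 :
    ∃ jbar : ConicPairs.Moduli → ℂ,
      -- `j` factors through `π`, by a unique map
      (∀ p, ConicPairs.jInv p = jbar (ConicPairs.proj p)) ∧
      (∀ f : ConicPairs.Moduli → ℂ,
        (∀ p, ConicPairs.jInv p = f (ConicPairs.proj p)) → f = jbar) ∧
      -- `j̄` is holomorphic
      ContMDiff 𝓘(ℂ, ℂ × ℂ) 𝓘(ℂ, ℂ) ω (fun m : ConicPairs.regularLocus => jbar m) ∧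
      -- `j̄` is a submersion outside `X`
      (∀ m ∉ ConicPairs.criticalCurve, ∃ h : m ∈ ConicPairs.regularLocus,
        Function.Surjective (mfderiv 𝓘(ℂ, ℂ × ℂ) 𝓘(ℂ, ℂ)
          (fun m : ConicPairs.regularLocus => jbar m) ⟨m, h⟩)) ∧
      -- the critical values of `j̄`
      {z | ∃ m : ConicPairs.regularLocus, ¬ Function.Surjective (mfderiv 𝓘(ℂ, ℂ × ℂ) 𝓘(ℂ, ℂ)
        (fun m : ConicPairs.regularLocus => jbar m) m) ∧ jbar m = z} = {0, 1728} ∧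
      -- `j` is holomorphic, and a submersion outside `π⁻¹(X)`
      ContMDiff (𝓘(ℂ, Fin 5 → ℂ).prod 𝓘(ℂ, Fin 5 → ℂ)) 𝓘(ℂ, ℂ) ω ConicPairs.jInv ∧
      (∀ p ∉ ConicPairs.proj ⁻¹' ConicPairs.criticalCurve, Function.Surjective
        (mfderiv (𝓘(ℂ, Fin 5 → ℂ).prod 𝓘(ℂ, Fin 5 → ℂ)) 𝓘(ℂ, ℂ) ConicPairs.jInv p)) ∧
      -- the critical values of `j`
      {z | ∃ p, ¬ Function.Surjective (mfderiv (𝓘(ℂ, Fin 5 → ℂ).prod 𝓘(ℂ, Fin 5 → ℂ)) 𝓘(ℂ, ℂ)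
        ConicPairs.jInv p) ∧ ConicPairs.jInv p = z} = {0, 1728} ∧
      -- the critical values correspond to the curves with extra automorphisms
      (∀ p, (ConicPairs.jInv p = 0 → Nat.card (MulAction.stabilizer
          (WeierstrassCurve.VariableChange ℂ) (ConicPairs.ellipticCurve p)) = 6) ∧
        (ConicPairs.jInv p = 1728 → Nat.card (MulAction.stabilizer
          (WeierstrassCurve.VariableChange ℂ) (ConicPairs.ellipticCurve p)) = 4) ∧
        (ConicPairs.jInv p ≠ 0 → ConicPairs.jInv p ≠ 1728 → Nat.card (MulAction.stabilizer
          (WeierstrassCurve.VariableChange ℂ) (ConicPairs.ellipticCurve p)) = 2)) := by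
  refine ⟨ConicPairs.jBar, ConicPairs.jInv_eq_jBar, fun f hf => funext fun m => ?_,
    fun m => (ConicPairs.jBar_chart m).1, fun m hm => ?_, ?_,
    fun p => (ConicPairs.jInv_chart p).1, fun p hp => ?_, ?_, ConicPairs.card_automorphisms⟩
  · obtain ⟨p, rfl⟩ := ConicPairs.proj_surjective m
    rw [← hf, ConicPairs.jInv_eq_jBar]
  · exact ⟨ConicPairs.mem_regularLocus_of_notMem_criticalCurve hm,
      (ConicPairs.jBar_chart _).2.2 (ConicPairs.not_eq_of_notMem_criticalCurve hm)⟩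
  -- Critical points are characterized by their values, so the critical values are those among 0 and
  -- 1728 that are attained.
  · ext z
    simp only [Set.mem_ofPred_eq, (ConicPairs.jBar_chart _).2, not_not, Set.mem_insert_iff,
      Set.mem_singleton_iff]
    constructor
    · rintro ⟨m, hm, rfl⟩
      exact hm
    · rintro (rfl | rfl)
      · obtain ⟨m, hm⟩ := ConicPairs.exists_jBar_eq_zero
        exact ⟨m, Or.inl hm, hm⟩
      · obtain ⟨m, hm⟩ := ConicPairs.exists_jBar_eq
        exact ⟨m, Or.inr hm, hm⟩
  · rw [(ConicPairs.jInv_chart p).2, ConicPairs.jInv_eq_jBar]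
    exact ConicPairs.not_eq_of_notMem_criticalCurve hp
  · ext z
    simp only [Set.mem_ofPred_eq, (ConicPairs.jInv_chart _).2, not_not, Set.mem_insert_iff,
      Set.mem_singleton_iff]
    -- The projection is surjective, so the values attained on the regular locus are also attained
    -- on the space of pairs.
    have hex : ∀ m : ConicPairs.Moduli, ∃ p, ConicPairs.jInv p = ConicPairs.jBar m := fun m => by
      obtain ⟨p, rfl⟩ := ConicPairs.proj_surjective m
      exact ⟨p, ConicPairs.jInv_eq_jBar p⟩
    constructor
    · rintro ⟨p, hp, rfl⟩
      exact hp
    · rintro (rfl | rfl)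
      · obtain ⟨m, hm⟩ := ConicPairs.exists_jBar_eq_zero
        obtain ⟨p, hp⟩ := hex m
        exact ⟨p, Or.inl (hp.trans hm), hp.trans hm⟩
      · obtain ⟨m, hm⟩ := ConicPairs.exists_jBar_eq
        obtain ⟨p, hp⟩ := hex m
        exact ⟨p, Or.inr (hp.trans hm), hp.trans hm⟩
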